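/- Let $A$ be a commutative noetherian ring. For an $A$-module $M$, let $\mathrm{Asso}_A(M)$ be the set of its associated primes, and for a prime ideal $\mathcal P$ put $M(\mathcal P)=\{m\in M:\exists n\ge 1,\ \mathcal P^n m=0\}$. Ideals $I,J$ are called disjoint if $I+J=A$. The module $M$ is called meager if for no simple $A$-module $S$ is $S^2=S\oplus S$ isomorphic to a subquotient (a quotient of a submodule) of $M$. The coheight of a prime $\mathcal P$ of a ring $R$ is the Krull dimension of $R/\mathcal P$. 0) If the associated primes of $M$ are pairwise disjoint, then $M=\bigoplus_{\mathcal P\in\mathrm{Asso}_A(M)}M(\mathcal P)$ and $\mathrm{Asso}_A(M(\mathcal P))=\{\mathcal P\}$ for all $\mathcal P\in\mathrm{Asso}_A(M)$. 1) Let $M$ be a meager $A$-module. Then its associated primes are pairwise disjoint, and $M$ has a unique decomposition as an internal direct sum $M=\bigoplus_{\mathcal P\in\mathrm{Asso}_A(M)}N_{\mathcal P}$ of submodules with $\mathrm{Asso}_A(N_{\mathcal P})=\{\mathcal P\}$ for all $\mathcal P$ (so $N_{\mathcal P}=M(\mathcal P)$, by 0)). Conversely, if $X$ is a set of pairwise disjoint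 prime ideals of $A$ and, for each $\mathcal P\in X$, $M_{\mathcal P}$ is a meager $A$-module with $\mathrm{Asso}_A(M_{\mathcal P})=\{\mathcal P\}$, then $\bigoplus_{\mathcal P\in X}M_{\mathcal P}$ is meager. 2) Let $M$ be a meager $A$-module with a single associated prime $\mathcal P$. Then exactly one of the following holds: (i) $M$ has nonzero finite length and its submodules form a chain; (ii) $\mathcal P$ is maximal, and there is a prime ideal $\mathcal Q$ of coheight $1$ in the completed local ring $\widehat{A_{\mathcal P}}$ such that $B=\widehat{A_{\mathcal P}}/\mathcal Q$ is a discrete valuation ring and $M$ is isomorphic to $\mathrm{Frac}(B)/B$ as an $A$-module; (iii) $\mathcal P$ has coheight $1$, the ring $A/\mathcal P$ is a Dedekind domain, and $M$ is a torsion-free module of rank $1$ over $A/\mathcal P$ (in particular $\mathcal PM=0$). For every prime $\mathcal P$ of $A$, an $A$-module is a torsion-free $A/\mathcal P$-module of rank $1$ if and only if it is isomorphic, as an $A$-module, to a nonzero submodule of $\mathrm{Frac}(A/\mathcal P)$. Conversely, every $A$-module as in (i) is meager with a single associated prime, which is a maximal ideal, and, for every prime $\mathcal P$ of $A$, every $A$-module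 as in (ii) or (iii) is meager with $\mathcal P$ as its only associated prime. Moreover, the prime $\mathcal Q$ in (ii) is unique. The module $M$ is artinian in cases (i) and (ii) but not in case (iii). It is finitely generated in case (i) but not in case (ii); whenever $\mathcal P$ has coheight $1$ and $A/\mathcal P$ is Dedekind, $A/\mathcal P$ is a finitely generated, and $\mathrm{Frac}(A/\mathcal P)$ a non-finitely generated, module as in (iii). In case (iii) the annihilator of $M$ in $A$ is $\mathcal P$. In case (ii), $M$ admits an $\widehat{A_{\mathcal P}}$-module structure compatible with its $A$-module structure, and for any such structure the annihilator of $M$ in $\widehat{A_{\mathcal P}}$ is $\mathcal Q$. -/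

import Mathlib

open scoped DirectSum

universe u v

/-- `L` is (isomorphic to) a subquotient of `M`: a quotient of a submodule of `M`. -/
def IsSubquotient (A : Type*) [CommRing A] (L M : Type*) [AddCommGroup L] [Module A L]
    [AddCommGroup M] [Module A M] : Prop :=
  ∃ (N : Submodule A M) (K : Submodule A N), Nonempty ((N ⧸ K) ≃ₗ[A] L)

/-- `M` is meager: for no simple module `S` is `S × S` a subquotient of `M`.
Every simple `A`-module is isomorphic to some `A ⧸ 𝔪`, so that it is enough to let `S` range
over the universe of `A`. -/
def IsMeager (A : Type u) [CommRing A] (M : Type*) [AddCommGroup M] [Module A M] : Prop :=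
  ∀ (S : Type u) [AddCommGroup S] [Module A S], IsSimpleModule A S →
    ¬ IsSubquotient A (S × S) M

/-- The ideals in `X` are pairwise disjoint, i.e. pairwise comaximal. -/
def PairwiseComaximal {A : Type*} [CommRing A] (X : Set (Ideal A)) : Prop :=
  X.Pairwise fun I J => I ⊔ J = ⊤

/-- The `P`-primary part `M(P) = {m ∈ M : P ^ n m = 0 for some n ≥ 1}`. -/
def primaryPart {A : Type*} [CommRing A] (P : Ideal A) (M : Type*) [AddCommGroup M] [Module A M] :
    Submodule A M where
  carrier := {m | ∃ n : ℕ, 1 ≤ n ∧ ∀ a ∈ P ^ n, a • m = 0}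
  zero_mem' := ⟨1, le_rfl, fun a _ => smul_zero a⟩
  add_mem' := by
    rintro x y ⟨n, hn, hx⟩ ⟨k, hk, hy⟩
    refine ⟨n + k, by omega, fun a ha => ?_⟩
    rw [smul_add, hx a (Ideal.pow_le_pow_right (Nat.le_add_right n k) ha),
      hy a (Ideal.pow_le_pow_right (Nat.le_add_left k n) ha), add_zero]
  smul_mem' := by
    rintro c x ⟨n, hn, hx⟩
    refine ⟨n, hn, fun a ha => ?_⟩
    rw [smul_comm, hx a ha, smul_zero]

open scoped Classical in
/-- `N` is a decomposition of `M` as an (internal) direct sum `M = ⨁ N(P)`, over the associated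
primes `P` of `M`, of submodules such that `P` is the only associated prime of `N(P)`. -/
def IsPrimaryDecomposition {A : Type*} [CommRing A] {M : Type*} [AddCommGroup M] [Module A M]
    (N : associatedPrimes A M → Submodule A M) : Prop :=
  DirectSum.IsInternal N ∧ ∀ P, associatedPrimes A (N P) = {P.1}

/-- The completed local ring of `A` at the prime `P`: the completion of `A_P` with respect to
its maximal ideal. -/
abbrev CompletedLocalization {A : Type*} [CommRing A] (P : Ideal A) [P.IsPrime] : Type _ :=
  AdicCompletion (IsLocalRing.maximalIdeal (Localization.AtPrime P)) (Localization.AtPrime P)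

/-- `Frac(B) / B` as an `A`-module, for an `A`-algebra `B`: the quotient of `Frac(B)` by the image
of `B`. -/
abbrev FracModSelf (A B : Type*) [CommRing A] [CommRing B] [Algebra A B] : Type _ :=
  FractionRing B ⧸ LinearMap.range (IsScalarTower.toAlgHom A B (FractionRing B)).toLinearMap

/-- `M` is nonzero, of finite length, and its submodules form a chain. -/
def IsUniserialOfFiniteLength (A : Type*) [CommRing A] (M : Type*) [AddCommGroup M]
    [Module A M] : Prop :=
  Nontrivial M ∧ IsFiniteLength A M ∧ ∀ N K : Submodule A M, N ≤ K ∨ K ≤ N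

/-- `P` is maximal, `Q` is a prime ideal of coheight one of the completed local ring of `A` at
`P`, the quotient `B` by `Q` is a discrete valuation ring, and `M` is isomorphic to `Frac(B) / B`
as an `A`-module. -/
def IsFracModDVR {A : Type*} [CommRing A] (P : Ideal A) [P.IsPrime]
    (Q : Ideal (CompletedLocalization P)) (M : Type*) [AddCommGroup M] [Module A M] : Prop :=
  P.IsMaximal ∧ ∃ _ : Q.IsPrime, ringKrullDim (CompletedLocalization P ⧸ Q) = 1 ∧
    IsDiscreteValuationRing (CompletedLocalization P ⧸ Q) ∧
    Nonempty (M ≃ₗ[A] FracModSelf A (CompletedLocalization P ⧸ Q))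

/-- The `A`-module `M` is an `A ⧸ P`-module (that is, `P M = 0`), and as such it is torsion-free
of rank one. -/
def IsTorsionFreeRankOne {A : Type*} [CommRing A] (P : Ideal A) (M : Type*)
    [AddCommGroup M] [Module A M] : Prop :=
  ∃ (_ : Module (A ⧸ P) M) (_ : IsScalarTower A (A ⧸ P) M),
    Module.IsTorsionFree (A ⧸ P) M ∧ Module.rank (A ⧸ P) M = 1

/-- `P` has coheight one and `A ⧸ P` is a Dedekind domain. -/
def IsDedekindPrime {A : Type*} [CommRing A] (P : Ideal A) : Prop :=
  ringKrullDim (A ⧸ P) = 1 ∧ IsDedekindDomain (A ⧸ P)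

/-- `P` has coheight one, `A ⧸ P` is a Dedekind domain, and `M` is a torsion-free module of rank
one over `A ⧸ P`. -/
def IsDedekindRankOne {A : Type*} [CommRing A] (P : Ideal A) (M : Type*)
    [AddCommGroup M] [Module A M] : Prop :=
  IsDedekindPrime P ∧ IsTorsionFreeRankOne P M

/-! Meagerness is a condition on pairs of elements (`isMeager_iff`): for each maximal ideal `m`, any
`x` and `y` satisfy a relation `a x + b y = 0` whose coefficients are not both in `m`. Everything
below is obtained by choosing `x`, `y` and `m` well.

If elements with annihilators `P ≠ Q` had both primes inside one `m`, no such relation could exist,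
so associated primes are comaximal. Some power of the intersection of finitely many of them kills a
given element, and the Chinese remainder theorem then splits the module into primary parts.

Now let `P` be the only associated prime. If `P` is maximal, elements outside `P` act invertibly on
`M`, so a relation can be divided by a coefficient outside `P`: `M` is uniserial
(`IsMeager.isUniserial`), hence artinian. If it has infinite length, some `t ∈ P` acts surjectively
with the socle as kernel, and dividing a socle element repeatedly by `t` gives generators `x k`,
with `x k` in the role of `t⁻ᵏ`. Two such sequences differ by an element of the completed local
ring, built as a limit (`IsDivisibleUniserial.exists_smul_eq`). Hence each element of that ring acts
as zero or as an automorphism times a power of `t`, so the quotient `B` by the annihilator is a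
discrete valuation ring, and `a / tⁿ ↦ a x n` identifies `Frac(B) / B` with `M`.

If `P` is not maximal, Nakayama's lemma gives `P M = 0` (`IsMeager.isDedekindRankOne`). The
relations then say that `M` has rank one and, applied to multiples of one element, that every
localization of `A ⧸ P` at a nonzero prime is a valuation ring, so `A ⧸ P` is Dedekind. The
converses run the same arguments backwards. -/

section Criterion

/-! ### Meagerness in terms of relations between two elements. -/

variable {A : Type u} [CommRing A] {M : Type*} [AddCommGroup M] [Module A M]

/-- A module is meager if and only if no two elements are such that all their relations have
coefficients in a given maximal ideal. -/
theorem isMeager_iff : IsMeager A M ↔ ∀ m : Ideal A, m.IsMaximal → ∀ x y : M,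
    ∃ a b : A, (a ∉ m ∨ b ∉ m) ∧ a • x + b • y = 0 := by
  constructor
  · intro h m hm x y
    by_contra! hxy
    let φ : A × A →ₗ[A] M := (LinearMap.toSpanSingleton A M x).coprod
      (LinearMap.toSpanSingleton A M y)
    let g : A × A →ₗ[A] (A ⧸ m) × (A ⧸ m) := m.mkQ.prodMap m.mkQ
    have hg : Function.Surjective g :=
      Function.Surjective.prodMap m.mkQ_surjective m.mkQ_surjective
    -- All relations between `x` and `y` lie in `m × m`, so the submodule they generate surjects
    -- onto `(A ⧸ m)²`.
    have hker : LinearMap.ker φ ≤ LinearMap.ker g := by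
      rintro ⟨a, b⟩ hab
      have hab' : a • x + b • y = 0 := by simpa [φ] using hab
      have h1 : a ∈ m ∧ b ∈ m := by
        by_contra hn
        exact hxy a b (by tauto) hab'
      simpa [g, Ideal.Quotient.eq_zero_iff_mem] using h1
    let ψ : LinearMap.range φ →ₗ[A] (A ⧸ m) × (A ⧸ m) :=
      (LinearMap.ker φ).liftQ g hker ∘ₗ φ.quotKerEquivRange.symm.toLinearMap
    have hψ : Function.Surjective ψ := by
      refine Function.Surjective.comp (g := (LinearMap.ker φ).liftQ g hker) ?_
        φ.quotKerEquivRange.symm.surjective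
      intro z
      obtain ⟨w, rfl⟩ := hg z
      exact ⟨Submodule.Quotient.mk w, by simp⟩
    have : IsSimpleModule A (A ⧸ m) := (isSimpleModule_iff_quot_maximal).2
      ⟨m, hm, ⟨LinearEquiv.refl _ _⟩⟩
    exact h (A ⧸ m) this ⟨LinearMap.range φ, LinearMap.ker ψ,
      ⟨ψ.quotKerEquivOfSurjective hψ⟩⟩
  · rintro h S _ _ hS ⟨N, K, ⟨e⟩⟩
    obtain ⟨m, hm, ⟨f⟩⟩ := isSimpleModule_iff_quot_maximal.1 hS
    obtain ⟨x, hx⟩ := K.mkQ_surjective (e.symm (f.symm 1, 0))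
    obtain ⟨y, hy⟩ := K.mkQ_surjective (e.symm (0, f.symm 1))
    obtain ⟨a, b, hab, hr⟩ := h m hm (x : M) (y : M)
    have hr' : a • x + b • y = 0 := Subtype.ext (by simpa using hr)
    have h2 : e (K.mkQ (a • x + b • y)) = 0 := by rw [hr', map_zero, map_zero]
    rw [map_add, map_smul, map_smul, hx, hy, map_add, map_smul, map_smul, e.apply_symm_apply,
      e.apply_symm_apply] at h2
    have h3 : a • f.symm 1 = 0 ∧ b • f.symm 1 = 0 := by simpa using h2
    have key : ∀ c : A, c • f.symm 1 = 0 → c ∈ m := by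
      intro c hc
      have h4 : c • (1 : A ⧸ m) = 0 := by
        rwa [← map_smul, f.symm.map_eq_zero_iff] at hc
      rw [← Ideal.Quotient.eq_zero_iff_mem]
      simpa [Algebra.smul_def] using h4
    rcases hab with ha | hb
    · exact ha (key a h3.1)
    · exact hb (key b h3.2)

end Criterion

/-! ### Primary parts and the direct sum decomposition. -/

section PrimaryPart

variable {A : Type u} [CommRing A] {M : Type*} [AddCommGroup M] [Module A M]

theorem pow_sup_pow_eq_top {I J : Ideal A} (h : I ⊔ J = ⊤) (m n : ℕ) : I ^ m ⊔ J ^ n = ⊤ :=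
  Ideal.isCoprime_iff_sup_eq.1 ((Ideal.isCoprime_iff_sup_eq.2 h).pow)

/-- A sum of elements of the other parts is killed by some `s ≡ 1` modulo `p i ^ k`; if `p i ^ k`
kills it as well, then so does `1`. -/
theorem iSupIndep_primaryPart {ι : Type*} (p : ι → Ideal A)
    (hp : Pairwise fun i j => p i ⊔ p j = ⊤) : iSupIndep fun i => primaryPart (p i) M := by
  rw [iSupIndep_def]
  intro i
  rw [Submodule.disjoint_def]
  rintro x ⟨k, -, hk⟩ hx
  have key : ∀ z ∈ ⨆ j, ⨆ (_ : j ≠ i), primaryPart (p j) M,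
      ∃ s : A, s • z = 0 ∧ 1 - s ∈ p i ^ k := by
    intro z hz
    rw [iSup_subtype'] at hz
    induction hz using Submodule.iSup_induction' with
    | mem j z hz =>
      obtain ⟨n, -, hn⟩ := hz
      have h1 : (1 : A) ∈ p j ^ n ⊔ p i ^ k := by
        rw [pow_sup_pow_eq_top (hp j.2)]; trivial
      obtain ⟨s, hs, t, ht, hst⟩ := Submodule.mem_sup.1 h1
      exact ⟨s, hn s hs, by rwa [← hst, add_sub_cancel_left]⟩
    | zero => exact ⟨1, by simp, by simp⟩
    | add z w _ _ hz hw =>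
      obtain ⟨s, hs, hs'⟩ := hz
      obtain ⟨t, ht, ht'⟩ := hw
      refine ⟨s * t, ?_, ?_⟩
      · rw [smul_add, mul_comm, mul_smul, hs, mul_comm, mul_smul, ht]; simp
      · have : 1 - s * t = (1 - s) + s * (1 - t) := by ring
        rw [this]
        exact Ideal.add_mem _ hs' (Ideal.mul_mem_left _ _ ht')
  obtain ⟨s, hs, hs'⟩ := key x hx
  have := hk _ hs'
  rwa [sub_smul, hs, one_smul, sub_zero] at this

/-- Yields uniqueness of the decomposition: a spanning family has no room to be strictly smaller
than an independent one. -/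
theorem eq_of_iSupIndep_of_le {ι : Type*} {N K : ι → Submodule A M} (hle : ∀ i, N i ≤ K i)
    (hN : ⨆ i, N i = ⊤) (hK : iSupIndep K) : N = K := by
  funext i
  refine le_antisymm (hle i) fun x hx => ?_
  have htop : N i ⊔ ⨆ (j) (_ : j ≠ i), K j = ⊤ := by
    rw [eq_top_iff, ← hN]
    refine iSup_le fun j => ?_
    by_cases hj : j = i
    · subst hj; exact le_sup_left
    · exact (hle j).trans (le_sup_of_le_right (le_iSup₂_of_le j hj le_rfl))
  obtain ⟨y, hy, z, hz, rfl⟩ := Submodule.mem_sup.1 (htop ▸ Submodule.mem_top : x ∈ _)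
  have hz' : z ∈ K i := by simpa using sub_mem hx (hle i hy)
  have : z = 0 := Submodule.disjoint_def.1 (iSupIndep_def.1 hK i) z hz' hz
  rwa [this, add_zero]

variable [IsNoetherianRing A]

theorem mem_associatedPrimes_iff {P : Ideal A} :
    P ∈ associatedPrimes A M ↔ P.IsPrime ∧ ∃ x : M, ∀ a, a ∈ P ↔ a • x = 0 := by
  rw [AssociatedPrimes.mem_iff, isAssociatedPrime_iff]
  refine and_congr_right fun _ => exists_congr fun x => ?_
  simp [Ideal.ext_iff, Submodule.mem_colon_singleton]

/-- An element is killed by the product of powers of finitely many associated primes. -/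
theorem exists_finset_associatedPrimes_pow_smul (x : M) :
    ∃ (s : Finset (Ideal A)) (n : ℕ), (s : Set (Ideal A)) ⊆ associatedPrimes A M ∧
      ∀ a ∈ (⨅ P ∈ s, P) ^ (n + 1), a • x = 0 := by
  set I : Ideal A := Submodule.colon (⊥ : Submodule A M) {x} with hI
  have hfin : I.minimalPrimes.Finite := Ideal.finite_minimalPrimes_of_isNoetherianRing A I
  -- Minimal primes over the annihilator `I` of `x` are associated to `M`; their intersection is the
  -- radical of `I`, a power of which lies in `I`. The exponent `n + 1` is there because
  -- `primaryPart` asks for a positive one.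
  refine ⟨hfin.toFinset, ?_⟩
  have hrad : (⨅ P ∈ hfin.toFinset, P) = I.radical := by
    rw [← Ideal.sInf_minimalPrimes, sInf_eq_iInf]
    simp
  obtain ⟨n, hn⟩ := Ideal.exists_radical_pow_le_of_fg I (IsNoetherian.noetherian _)
  refine ⟨n, ?_, ?_⟩
  · intro P hP
    have hP' : P ∈ I.minimalPrimes := by simpa using hP
    rw [AssociatedPrimes.mem_iff, isAssociatedPrime_iff]
    exact ⟨hP'.1.1, Submodule.exists_eq_colon_of_mem_minimalPrimes hP'⟩
  · intro a ha
    rw [hrad] at ha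
    have := hn (Ideal.pow_le_pow_right (Nat.le_succ n) ha)
    simpa [hI, Submodule.mem_colon_singleton] using this

theorem primaryPart_eq_top {P : Ideal A} (h : associatedPrimes A M = {P}) :
    primaryPart P M = ⊤ := by
  rw [eq_top_iff]
  intro x _
  obtain ⟨s, n, hs, hn⟩ := exists_finset_associatedPrimes_pow_smul (A := A) x
  refine ⟨n + 1, by omega, fun a ha => hn a (Ideal.pow_right_mono ?_ _ ha)⟩
  refine le_iInf₂ fun Q hQ => ?_
  have : Q ∈ associatedPrimes A M := hs hQ
  rw [h] at this
  exact (Set.mem_singleton_iff.1 this).ge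

/-- By the Chinese remainder theorem, torsion for an intersection of pairwise comaximal powers is
the sum of the torsions for the individual powers. -/
theorem iSup_primaryPart_eq_top (h : PairwiseComaximal (associatedPrimes A M)) :
    ⨆ P : associatedPrimes A M, primaryPart P.1 M = ⊤ := by
  classical
  rw [eq_top_iff]
  intro x _
  obtain ⟨s, n, hs, hn⟩ := exists_finset_associatedPrimes_pow_smul (A := A) x
  have hp : (s : Set (Ideal A)).Pairwise fun I J => I ^ (n + 1) ⊔ J ^ (n + 1) = ⊤ :=
    fun I hI J hJ hIJ => pow_sup_pow_eq_top (h (hs hI) (hs hJ) hIJ) _ _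
  have h1 := Submodule.iSup_torsionBySet_ideal_eq_torsionBySet_iInf (M := M) hp
  have hx : x ∈ Submodule.torsionBySet A M ((⨅ I ∈ s, I ^ (n + 1) : Ideal A) : Set A) := by
    rw [Submodule.mem_torsionBySet_iff]
    rintro ⟨a, ha⟩
    refine hn a ?_
    have h2 : (⨅ I ∈ s, I ^ (n + 1) : Ideal A) = ∏ I ∈ s, I ^ (n + 1) :=
      (Ideal.prod_eq_iInf_of_pairwise_isCoprime fun I hI J hJ hIJ =>
        Ideal.isCoprime_iff_sup_eq.2 (hp hI hJ hIJ)).symm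
    rw [SetLike.mem_coe, h2, Finset.prod_pow] at ha
    refine Ideal.pow_right_mono ?_ _ ha
    exact Ideal.prod_le_inf.trans (by rw [Finset.inf_eq_iInf])
  rw [← h1] at hx
  refine (iSup₂_le fun I hI => ?_ : _ ≤ ⨆ P : associatedPrimes A M, primaryPart P.1 M) hx
  refine le_trans ?_ (le_iSup _ (⟨I, hs hI⟩ : associatedPrimes A M))
  intro z hz
  rw [Submodule.mem_torsionBySet_iff] at hz
  exact ⟨n + 1, by omega, fun a ha => hz ⟨a, ha⟩⟩

theorem isPrimaryDecomposition_primaryPart (h : PairwiseComaximal (associatedPrimes A M)) :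
    IsPrimaryDecomposition fun P : associatedPrimes A M => primaryPart P.1 M := by
  refine ⟨(DirectSum.isInternal_submodule_iff_iSupIndep_and_iSup_eq_top _).2
    ⟨iSupIndep_primaryPart _ fun P Q hPQ => h P.2 Q.2 fun e => hPQ (Subtype.ext e),
      iSup_primaryPart_eq_top h⟩, fun P => ?_⟩
  ext Q
  rw [Set.mem_singleton_iff]
  constructor
  · intro hQ
    by_contra hne
    have hQ' : Q ∈ associatedPrimes A M :=
      associatedPrimes.subset_of_injective (Submodule.subtype_injective _) hQ
    obtain ⟨hQp, ⟨x, n, _, hn⟩, hx⟩ := mem_associatedPrimes_iff.1 hQ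
    have hle : P.1 ≤ Q := by
      refine hQp.le_of_pow_le (n := n) fun a ha => (hx a).2 (Subtype.ext (hn a ha))
    have : P.1 ⊔ Q = ⊤ := h P.2 hQ' (Ne.symm hne)
    rw [sup_eq_right.2 hle] at this
    exact hQp.ne_top this
  · rintro rfl
    obtain ⟨hp, x, hx⟩ := mem_associatedPrimes_iff.1 P.2
    refine mem_associatedPrimes_iff.2 ⟨hp, ⟨x, 1, le_rfl, fun a ha => (hx a).1 (by simpa using ha)⟩,
      fun a => ?_⟩
    rw [hx, Subtype.ext_iff]
    rfl

theorem IsPrimaryDecomposition.eq_primaryPart (h : PairwiseComaximal (associatedPrimes A M))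
    {N : associatedPrimes A M → Submodule A M} (hN : IsPrimaryDecomposition N) :
    N = fun P : associatedPrimes A M => primaryPart P.1 M := by
  refine eq_of_iSupIndep_of_le (fun P x hx => ?_)
    ((DirectSum.isInternal_submodule_iff_iSupIndep_and_iSup_eq_top _).1 hN.1).2
    (iSupIndep_primaryPart _ fun P Q hPQ => h P.2 Q.2 fun e => hPQ (Subtype.ext e))
  obtain ⟨n, hn, hx'⟩ : (⟨x, hx⟩ : N P) ∈ primaryPart P.1 (N P) := by
    rw [primaryPart_eq_top (hN.2 P)]; trivial
  exact ⟨n, hn, fun a ha => congrArg Subtype.val (hx' a ha)⟩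

theorem IsMeager.pairwiseComaximal (h : IsMeager A M) :
    PairwiseComaximal (associatedPrimes A M) := by
  rintro P hP Q hQ hPQ
  by_contra htop
  obtain ⟨m, hm, hle⟩ := Ideal.exists_le_maximal _ htop
  obtain ⟨hPp, x, hx⟩ := mem_associatedPrimes_iff.1 hP
  obtain ⟨hQp, y, hy⟩ := mem_associatedPrimes_iff.1 hQ
  obtain ⟨a, b, hab, hr⟩ := isMeager_iff.1 h m hm x y
  have hr' : a • x = -(b • y) := eq_neg_of_add_eq_zero_left hr
  by_cases ha : a ∈ P
  · have hb : b ∈ Q := by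
      rw [hy]
      rw [(hx a).1 ha, zero_add] at hr
      exact hr
    rcases hab with h' | h'
    · exact h' (hle (Ideal.mem_sup_left ha))
    · exact h' (hle (Ideal.mem_sup_right hb))
  by_cases hb : b ∈ Q
  · rw [(hy b).1 hb, neg_zero, ← hx] at hr'
    exact ha hr'
  -- Now `a ∉ P` and `b ∉ Q`, so the common element `a x = -(b y)` has annihilator both `P` and `Q`.
  refine hPQ (le_antisymm (fun c hc => ?_) fun c hc => ?_)
  · refine (hQp.mem_or_mem ((hy (c * b)).2 ?_)).resolve_right hb
    rw [mul_smul, ← neg_eq_zero, ← smul_neg, ← hr', smul_comm, (hx c).1 hc, smul_zero]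
  · refine (hPp.mem_or_mem ((hx (c * a)).2 ?_)).resolve_right ha
    rw [mul_smul, hr', smul_neg, smul_comm, (hy c).1 hc, smul_zero, neg_zero]

/-- Components at primes not inside `m` are killed by a multiplier outside `m`, and comaximality
leaves at most one prime of `X` inside `m`. A relation in that one summand suffices. -/
theorem IsMeager.directSum {X : Set (Ideal A)}
    (hXX : PairwiseComaximal X) {M : X → Type v} [∀ P, AddCommGroup (M P)] [∀ P, Module A (M P)]
    (hM : ∀ P, IsMeager A (M P)) (hass : ∀ P, associatedPrimes A (M P) = {P.1}) :
    IsMeager A (⨁ P, M P) := by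
  classical
  rw [isMeager_iff]
  intro m hm x y
  have key : ∀ z : ⨁ P, M P, ∃ s ∉ m, ∀ P : X, ¬ P.1 ≤ m → s • z P = 0 := by
    intro z
    induction z using DirectSum.induction_on with
    | zero => exact ⟨1, hm.ne_top ∘ (Ideal.eq_top_iff_one _).2, by simp⟩
    | of P z =>
      by_cases hP : P.1 ≤ m
      · refine ⟨1, hm.ne_top ∘ (Ideal.eq_top_iff_one _).2, fun Q hQ => ?_⟩
        have : P ≠ Q := by rintro rfl; exact hQ hP
        rw [DirectSum.of_eq_of_ne _ _ _ this.symm, smul_zero]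
      · obtain ⟨n, -, hn⟩ : z ∈ primaryPart P.1 (M P) := by
          rw [primaryPart_eq_top (hass P)]; trivial
        obtain ⟨s, hs, hsm⟩ := Set.not_subset.1 hP
        refine ⟨s ^ n, fun h => hsm (hm.isPrime.mem_of_pow_mem n h), fun Q _ => ?_⟩
        by_cases hPQ : P = Q
        · subst hPQ
          rw [DirectSum.of_eq_same]
          exact hn _ (Ideal.pow_mem_pow hs n)
        · rw [DirectSum.of_eq_of_ne _ _ _ (Ne.symm hPQ), smul_zero]
    | add z w hz hw =>
      obtain ⟨s, hs, hs'⟩ := hz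
      obtain ⟨t, ht, ht'⟩ := hw
      refine ⟨s * t, fun h => (hm.isPrime.mem_or_mem h).elim hs ht, fun P hP => ?_⟩
      rw [DirectSum.add_apply, smul_add, mul_smul s t (w P), ht' P hP, mul_comm, mul_smul,
        hs' P hP]
      simp
  obtain ⟨s, hs, hs'⟩ := key x
  obtain ⟨t, ht, ht'⟩ := key y
  have hst : ∀ a : A, a ∉ m → a * (s * t) ∉ m := fun a ha h =>
    (hm.isPrime.mem_or_mem h).elim ha fun h => (hm.isPrime.mem_or_mem h).elim hs ht
  have hx : ∀ P : X, ¬ P.1 ≤ m → (s * t) • x P = 0 := fun P hP => by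
    rw [mul_comm, mul_smul, hs' P hP, smul_zero]
  have hy : ∀ P : X, ¬ P.1 ≤ m → (s * t) • y P = 0 := fun P hP => by
    rw [mul_smul, ht' P hP, smul_zero]
  by_cases hex : ∃ P : X, P.1 ≤ m
  · obtain ⟨P, hP⟩ := hex
    obtain ⟨a, b, hab, hr⟩ := isMeager_iff.1 (hM P) m hm (x P) (y P)
    refine ⟨a * (s * t), b * (s * t), hab.imp (hst a) (hst b), ?_⟩
    ext Q
    rw [DirectSum.add_apply, DirectSum.smul_apply, DirectSum.smul_apply]
    by_cases hQ : Q.1 ≤ m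
    · have : Q = P := by
        by_contra hne
        have := hXX Q.2 P.2 fun e => hne (Subtype.ext e)
        exact hm.ne_top (eq_top_iff.2 (this ▸ sup_le hQ hP))
      subst this
      rw [mul_comm a, mul_comm b, mul_smul _ a, mul_smul _ b, ← smul_add, hr]
      simp
    · rw [mul_smul a, mul_smul b, hx Q hQ, hy Q hQ]
      simp
  · push Not at hex
    refine ⟨s * t, 0, Or.inl (by simpa using hst 1 (hm.ne_top ∘ (Ideal.eq_top_iff_one _).2)), ?_⟩
    ext Q
    rw [zero_smul, add_zero, DirectSum.smul_apply, hx Q (hex Q)]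
    simp

end PrimaryPart

/-! ### Uniserial modules: the case of a maximal associated prime. -/

section Uniserial

variable {A : Type u} [CommRing A] {M : Type*} [AddCommGroup M] [Module A M]

variable (A M) in
/-- Of two elements of `M`, one is a multiple of the other. -/
def IsUniserial : Prop := ∀ x y : M, (∃ a : A, x = a • y) ∨ ∃ a : A, y = a • x

theorem isUniserial_iff : IsUniserial A M ↔ ∀ N K : Submodule A M, N ≤ K ∨ K ≤ N := by
  constructor
  · intro h N K
    by_contra! hNK
    obtain ⟨x, hxN, hxK⟩ := Set.not_subset.1 hNK.1
    obtain ⟨y, hyK, hyN⟩ := Set.not_subset.1 hNK.2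
    rcases h x y with ⟨a, rfl⟩ | ⟨a, rfl⟩
    · exact hxK (K.smul_mem a hyK)
    · exact hyN (N.smul_mem a hxN)
  · intro h x y
    simp only [eq_comm (a := x), eq_comm (a := y), ← Submodule.mem_span_singleton]
    simpa only [Submodule.span_singleton_le_iff_mem] using
      h (Submodule.span A {x}) (Submodule.span A {y})

theorem IsUniserial.isMeager (h : IsUniserial A M) : IsMeager A M := by
  rw [isMeager_iff]
  intro m hm x y
  have h1 : (1 : A) ∉ m := hm.ne_top ∘ (Ideal.eq_top_iff_one _).2
  rcases h x y with ⟨a, rfl⟩ | ⟨a, rfl⟩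
  · exact ⟨1, -a, Or.inl h1, by simp⟩
  · exact ⟨-a, 1, Or.inr h1, by simp⟩

theorem IsUniserial.of_equiv {M' : Type*} [AddCommGroup M'] [Module A M'] (h : IsUniserial A M)
    (e : M ≃ₗ[A] M') : IsUniserial A M' := by
  intro x y
  simpa only [← map_smul, e.symm.injective.eq_iff] using h (e.symm x) (e.symm y)

theorem primaryPart_eq_top_of_equiv {P : Ideal A} {M' : Type*} [AddCommGroup M'] [Module A M']
    (h : primaryPart P M = ⊤) (e : M ≃ₗ[A] M') : primaryPart P M' = ⊤ := by
  rw [eq_top_iff]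
  intro x _
  obtain ⟨n, hn, hx⟩ : e.symm x ∈ primaryPart P M := by rw [h]; trivial
  exact ⟨n, hn, fun a ha => e.symm.injective (by rw [map_smul, hx a ha, map_zero])⟩

theorem exists_mul_sub_one_mem_pow {P : Ideal A} (hP : P.IsMaximal) {a : A} (ha : a ∉ P) (n : ℕ) :
    ∃ b, 1 - b * a ∈ P ^ n := by
  have h1 : Ideal.span {a} ⊔ P = ⊤ := by
    rw [sup_comm]
    exact (Ideal.isMaximal_def.1 hP).2 _ (lt_of_le_of_ne le_sup_left fun h =>
      ha (h ▸ Ideal.mem_sup_right (Ideal.mem_span_singleton_self a)))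
  have h2 := pow_sup_pow_eq_top h1 1 n
  obtain ⟨c, hc, d, hd, hcd⟩ := Submodule.mem_sup.1 ((Ideal.eq_top_iff_one _).1 h2)
  rw [pow_one] at hc
  obtain ⟨b, rfl⟩ := Ideal.mem_span_singleton'.1 hc
  exact ⟨b, by rwa [← hcd, add_sub_cancel_left]⟩

/-- An element outside `P` is invertible modulo each `P ^ n`, and some `P ^ n` kills `x`, so `a` can
be cancelled. -/
theorem exists_eq_smul_of_smul_eq {P : Ideal A} (hP : P.IsMaximal) (hM : primaryPart P M = ⊤)
    {a b : A} {x y : M} (ha : a ∉ P) (h : a • x = b • y) : ∃ c : A, x = c • y := by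
  obtain ⟨n, -, hn⟩ : x ∈ primaryPart P M := by rw [hM]; trivial
  obtain ⟨c, hc⟩ := exists_mul_sub_one_mem_pow hP ha n
  refine ⟨c * b, ?_⟩
  have := hn _ hc
  rwa [sub_smul, one_smul, mul_smul, h, ← mul_smul, sub_eq_zero] at this

theorem IsMeager.isUniserial {P : Ideal A} (hP : P.IsMaximal) (hM : primaryPart P M = ⊤)
    (h : IsMeager A M) : IsUniserial A M := by
  intro x y
  obtain ⟨a, b, hab, hr⟩ := isMeager_iff.1 h P hP x y
  rcases hab with ha | hb
  · exact Or.inl (exists_eq_smul_of_smul_eq hP hM (b := -b) ha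
      (by rw [neg_smul]; exact eq_neg_of_add_eq_zero_left hr))
  · exact Or.inr (exists_eq_smul_of_smul_eq hP hM (b := -a) hb
      (by rw [neg_smul]; exact eq_neg_of_add_eq_zero_right hr))

theorem isArtinianRing_quotient_pow [IsNoetherianRing A] {P : Ideal A} (hP : P.IsMaximal) (n : ℕ) :
    IsArtinianRing (A ⧸ P ^ n) := by
  have : Ring.KrullDimLE 0 (A ⧸ P ^ n) := by
    refine Ring.KrullDimLE.mk₀ fun J hJ => ?_
    have h1 : P ≤ J.comap (Ideal.Quotient.mk (P ^ n)) := by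
      refine (hJ.comap _).le_of_pow_le (n := n) fun a ha => ?_
      rw [Ideal.mem_comap, Ideal.Quotient.eq_zero_iff_mem.2 ha]
      exact J.zero_mem
    have h2 := hP.eq_of_le (hJ.comap _).ne_top h1
    have : (J.comap (Ideal.Quotient.mk (P ^ n))).IsMaximal := h2 ▸ hP
    rw [← Ideal.map_comap_of_surjective _ Ideal.Quotient.mk_surjective J]
    exact (Ideal.map_eq_top_or_isMaximal_of_surjective _ Ideal.Quotient.mk_surjective
      this).resolve_left fun h => hJ.ne_top (by
        rwa [Ideal.map_comap_of_surjective _ Ideal.Quotient.mk_surjective J] at h)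
  exact IsNoetherianRing.isArtinianRing_of_krullDimLE_zero

theorem isArtinian_span_singleton [IsNoetherianRing A] {P : Ideal A} (hP : P.IsMaximal) {x : M}
    (hx : x ∈ primaryPart P M) : IsArtinian A (Submodule.span A {x}) := by
  obtain ⟨n, -, hn⟩ := hx
  have h1 : Module.IsTorsionBySet A (Submodule.span A {x}) (P ^ n : Ideal A) := by
    rintro ⟨y, hy⟩ ⟨a, ha⟩
    obtain ⟨b, rfl⟩ := Submodule.mem_span_singleton.1 hy
    exact Subtype.ext (by simpa [smul_comm a b x] using by rw [hn a ha, smul_zero])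
  let _ := h1.module
  have : IsScalarTower A (A ⧸ P ^ n) (Submodule.span A {x}) := h1.isScalarTower
  have := isArtinianRing_quotient_pow hP n
  have : Module.Finite (A ⧸ P ^ n) (Submodule.span A {x}) :=
    Module.Finite.of_restrictScalars_finite A _ _
  exact isArtinian_of_surjective_algebraMap (R := A ⧸ P ^ n) Ideal.Quotient.mk_surjective

theorem IsUniserial.le_span_singleton (h : IsUniserial A M) {N : Submodule A M} {x : M}
    (hx : x ∉ N) : N ≤ Submodule.span A {x} :=
  (isUniserial_iff.1 h N _).resolve_right fun h' => hx (h' (Submodule.mem_span_singleton_self x))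

/-- A proper submodule lies in the span of any element outside it, and this span is a finite module
over the artinian ring `A ⧸ P ^ n` for some `n`. -/
theorem IsUniserial.isArtinian [IsNoetherianRing A] {P : Ideal A} (hP : P.IsMaximal)
    (hM : primaryPart P M = ⊤) (h : IsUniserial A M) : IsArtinian A M := by
  rw [← set_has_minimal_iff_artinian]
  intro a ha
  by_cases htop : ∃ N ∈ a, N ≠ ⊤
  · obtain ⟨N, hNa, hN⟩ := htop
    obtain ⟨x, -, hx⟩ := Set.not_subset.1 fun h : (⊤ : Submodule A M) ≤ N => hN (top_le_iff.1 h)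
    have hart := isArtinian_span_singleton hP (hM ▸ Submodule.mem_top : x ∈ primaryPart P M)
    have : IsArtinian A N := isArtinian_of_injective (Submodule.inclusion (h.le_span_singleton hx))
      (Submodule.inclusion_injective _)
    obtain ⟨K, hK, hmin⟩ := IsArtinian.set_has_minimal
      {K : Submodule A N | K.map N.subtype ∈ a} ⟨⊤, by simpa using hNa⟩
    refine ⟨_, hK, fun I hI hlt => hmin (I.comap N.subtype) ?_ ?_⟩
    · rwa [Set.mem_ofPred_eq, Submodule.map_comap_subtype,
        inf_eq_right.2 (hlt.le.trans (Submodule.map_subtype_le _ _))]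
    · refine lt_of_le_of_ne ?_ ?_
      · rw [← Submodule.comap_map_eq_of_injective N.subtype_injective K]
        exact Submodule.comap_mono hlt.le
      · rintro rfl
        rw [Submodule.map_comap_subtype] at hlt
        exact hlt.not_ge inf_le_right
  · push Not at htop
    obtain ⟨N, hN⟩ := ha
    exact ⟨N, hN, fun I hI hlt => hlt.ne ((htop I hI).trans (htop N hN).symm)⟩

theorem isMaximal_of_mem_associatedPrimes [IsNoetherianRing A] [IsArtinian A M] {P : Ideal A}
    (hP : P ∈ associatedPrimes A M) : P.IsMaximal := by
  obtain ⟨hp, f, hf⟩ := (isAssociatedPrime_iff_exists_injective_linearMap P M).1 hP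
  have h1 : IsArtinian A (A ⧸ P) := isArtinian_of_injective f hf
  have h2 : IsArtinianRing (A ⧸ P) := isArtinian_of_tower A h1
  exact Ideal.Quotient.maximal_of_isField _ (IsArtinianRing.isField_of_isDomain _)

theorem IsUniserialOfFiniteLength.isUniserial (h : IsUniserialOfFiniteLength A M) :
    IsUniserial A M :=
  isUniserial_iff.2 h.2.2

theorem IsUniserialOfFiniteLength.isArtinian (h : IsUniserialOfFiniteLength A M) :
    IsArtinian A M :=
  (isFiniteLength_iff_isNoetherian_isArtinian.1 h.2.1).2

theorem IsUniserialOfFiniteLength.finite (h : IsUniserialOfFiniteLength A M) :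
    Module.Finite A M :=
  have := (isFiniteLength_iff_isNoetherian_isArtinian.1 h.2.1).1
  inferInstance

theorem IsUniserialOfFiniteLength.exists_associatedPrimes_eq [IsNoetherianRing A]
    (h : IsUniserialOfFiniteLength A M) :
    ∃ P : Ideal A, P.IsMaximal ∧ associatedPrimes A M = {P} := by
  have := h.1
  have := h.isArtinian
  obtain ⟨P, hP⟩ := associatedPrimes.nonempty A M
  have hPm := isMaximal_of_mem_associatedPrimes hP
  refine ⟨P, hPm, Set.eq_singleton_iff_unique_mem.2 ⟨hP, fun Q hQ => ?_⟩⟩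
  have hQm := isMaximal_of_mem_associatedPrimes hQ
  obtain ⟨-, x, hx⟩ := mem_associatedPrimes_iff.1 hP
  obtain ⟨-, y, hy⟩ := mem_associatedPrimes_iff.1 hQ
  -- If `x = a y`, the annihilator of `y` is contained in that of `x`; both are maximal, hence
  -- equal.
  rcases h.isUniserial x y with ⟨a, rfl⟩ | ⟨a, rfl⟩
  · exact hQm.eq_of_le hPm.ne_top fun c hc => by
      rw [hx, smul_comm, (hy c).1 hc, smul_zero]
  · exact (hPm.eq_of_le hQm.ne_top fun c hc => by
      rw [hy, smul_comm, (hx c).1 hc, smul_zero]).symm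

end Uniserial

/-! ### Torsion-free modules of rank one over `A ⧸ P`. -/

section RankOne

variable {A : Type u} [CommRing A] {M : Type v} [AddCommGroup M] [Module A M]

/-- Elementwise form of being torsion-free of rank one over the quotient by a prime. -/
theorem isTorsionFreeRankOne_iff {P : Ideal A} [P.IsPrime] : IsTorsionFreeRankOne P M ↔
    Nontrivial M ∧ (∀ x : M, x ≠ 0 → ∀ a : A, a • x = 0 ↔ a ∈ P) ∧
      ∀ x y : M, ∃ a b : A, (a ∉ P ∨ b ∉ P) ∧ a • x + b • y = 0 := by
  constructor
  · rintro ⟨_, _, htf, hrk⟩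
    have hmk : ∀ (a : A) (x : M), Ideal.Quotient.mk P a • x = a • x := fun a x =>
      algebraMap_smul (A ⧸ P) a x
    refine ⟨?_, fun x hx a => ?_, fun x y => ?_⟩
    · by_contra hM
      rw [not_nontrivial_iff_subsingleton] at hM
      rw [rank_subsingleton'] at hrk
      exact zero_ne_one hrk
    · rw [← hmk, smul_eq_zero_iff_left hx, Ideal.Quotient.eq_zero_iff_mem]
    · have hdep : ¬ LinearIndependent (A ⧸ P) ![x, y] := by
        intro hli
        have := hli.cardinal_lift_le_rank
        rw [hrk] at this
        norm_num at this
      rw [LinearIndependent.pair_iff] at hdep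
      push Not at hdep
      obtain ⟨s, t, hst, hne⟩ := hdep
      obtain ⟨a, rfl⟩ := Ideal.Quotient.mk_surjective s
      obtain ⟨b, rfl⟩ := Ideal.Quotient.mk_surjective t
      rw [hmk, hmk] at hst
      refine ⟨a, b, ?_, hst⟩
      rw [Ideal.Quotient.eq_zero_iff_mem, ne_eq, Ideal.Quotient.eq_zero_iff_mem] at hne
      tauto
  · rintro ⟨hM, hann, hrel⟩
    have htors : Module.IsTorsionBySet A M P := by
      rintro x ⟨a, ha⟩
      by_cases hx : x = 0
      · rw [hx, smul_zero]
      · exact (hann x hx a).2 ha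
    let _ : Module (A ⧸ P) M := htors.module
    have hmk : ∀ (a : A) (x : M), Ideal.Quotient.mk P a • x = a • x := fun _ _ => rfl
    have htf : Module.IsTorsionFree (A ⧸ P) M := by
      refine Module.IsTorsionFree.of_smul_eq_zero fun r x hr => ?_
      obtain ⟨a, rfl⟩ := Ideal.Quotient.mk_surjective r
      rw [or_iff_not_imp_right]
      intro hx
      rwa [Ideal.Quotient.eq_zero_iff_mem, ← hann x hx]
    refine ⟨inferInstance, htors.isScalarTower, htf, le_antisymm ?_ ?_⟩
    · have := rank_le (R := A ⧸ P) (M := M) (n := 1) fun s hs => by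
        by_contra! hcard
        obtain ⟨x, hx, y, hy, hxy⟩ := Finset.one_lt_card.1 hcard
        have hli : LinearIndependent (A ⧸ P) ![x, y] := by
          have h1 := hs.comp ![⟨x, hx⟩, ⟨y, hy⟩] (by
            intro i j hij
            fin_cases i <;> fin_cases j <;> simp_all [eq_comm])
          convert h1 using 1
          funext i
          fin_cases i <;> rfl
        rw [LinearIndependent.pair_iff] at hli
        obtain ⟨a, b, hab, hr⟩ := hrel x y
        have := hli (Ideal.Quotient.mk P a) (Ideal.Quotient.mk P b) hr
        rw [Ideal.Quotient.eq_zero_iff_mem, Ideal.Quotient.eq_zero_iff_mem] at this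
        tauto
      simpa using this
    · exact Cardinal.one_le_iff_pos.2 rank_pos

theorem FractionRing.algebraMap_quotient_eq_zero_iff {P : Ideal A} [P.IsPrime] {a : A} :
    algebraMap (A ⧸ P) (FractionRing (A ⧸ P)) (Ideal.Quotient.mk P a) = 0 ↔ a ∈ P := by
  rw [map_eq_zero_iff _ (IsFractionRing.injective (A ⧸ P) (FractionRing (A ⧸ P))),
    Ideal.Quotient.eq_zero_iff_mem]

theorem FractionRing.smul_quotient_eq {P : Ideal A} [P.IsPrime] (a : A)
    (z : FractionRing (A ⧸ P)) :
    a • z = algebraMap (A ⧸ P) (FractionRing (A ⧸ P)) (Ideal.Quotient.mk P a) * z := by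
  rw [← Algebra.smul_def]
  exact (algebraMap_smul (A ⧸ P) a z).symm

theorem isTorsionFreeRankOne_of_injective {P : Ideal A} [P.IsPrime] [Nontrivial M]
    (f : M →ₗ[A] FractionRing (A ⧸ P)) (hf : Function.Injective f) : IsTorsionFreeRankOne P M := by
  have hann : ∀ x : M, x ≠ 0 → ∀ a : A, a • x = 0 ↔ a ∈ P := by
    intro x hx a
    rw [← map_eq_zero_iff f hf, map_smul, FractionRing.smul_quotient_eq, mul_eq_zero,
      FractionRing.algebraMap_quotient_eq_zero_iff, map_eq_zero_iff f hf]
    exact or_iff_left hx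
  refine isTorsionFreeRankOne_iff.2 ⟨inferInstance, hann, fun x y => ?_⟩
  by_cases hx : x = 0
  · exact ⟨1, 0, Or.inl ((Ideal.ne_top_iff_one P).1 Ideal.IsPrime.ne_top'), by simp [hx]⟩
  obtain ⟨⟨p, d⟩, hp⟩ := IsLocalization.surj (nonZeroDivisors (A ⧸ P)) (f x)
  obtain ⟨⟨q, e⟩, hq⟩ := IsLocalization.surj (nonZeroDivisors (A ⧸ P)) (f y)
  -- With `f x = p / d` and `f y = q / e`, the relation is `(q d) x - (p e) y = 0`.
  obtain ⟨a, ha⟩ := Ideal.Quotient.mk_surjective (q * (d : A ⧸ P))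
  obtain ⟨b, hb⟩ := Ideal.Quotient.mk_surjective (p * (e : A ⧸ P))
  refine ⟨a, -b, Or.inr ?_, hf ?_⟩
  · rw [neg_mem_iff, ← FractionRing.algebraMap_quotient_eq_zero_iff, hb, map_mul, ← hp]
    have h1 : ∀ c : nonZeroDivisors (A ⧸ P),
        algebraMap (A ⧸ P) (FractionRing (A ⧸ P)) c ≠ 0 := fun c =>
      IsFractionRing.to_map_ne_zero_of_mem_nonZeroDivisors c.2
    exact mul_ne_zero (mul_ne_zero ((map_ne_zero_iff f hf).2 hx) (h1 d)) (h1 e)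
  · rw [map_add, map_smul, map_smul, FractionRing.smul_quotient_eq,
      FractionRing.smul_quotient_eq, map_neg, map_neg, ha, hb, map_zero, map_mul, map_mul,
      ← hp, ← hq]
    ring

/-- Fix `x₀ ≠ 0`. Rank one gives `a y = b x₀` with `a ∉ P`, and `y ↦ b / a` does not depend on the
choice of `a` and `b`, by torsion-freeness. -/
theorem IsTorsionFreeRankOne.exists_injective {P : Ideal A} [P.IsPrime]
    (h : IsTorsionFreeRankOne P M) :
    ∃ f : M →ₗ[A] FractionRing (A ⧸ P), Function.Injective f := by
  obtain ⟨hM, hann, hrel⟩ := isTorsionFreeRankOne_iff.1 h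
  obtain ⟨x₀, hx₀⟩ := exists_ne (0 : M)
  let ι : A → FractionRing (A ⧸ P) := fun a =>
    algebraMap (A ⧸ P) (FractionRing (A ⧸ P)) (Ideal.Quotient.mk P a)
  have hι : ∀ {a}, ι a = 0 ↔ a ∈ P := FractionRing.algebraMap_quotient_eq_zero_iff
  have hex : ∀ y : M, ∃ ab : A × A, ab.1 ∉ P ∧ ab.1 • y = ab.2 • x₀ := by
    intro y
    obtain ⟨a, b, hab, hr⟩ := hrel y x₀
    have hr' : a • y = (-b) • x₀ := by rw [neg_smul]; exact eq_neg_of_add_eq_zero_left hr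
    refine ⟨(a, -b), fun ha => ?_, hr'⟩
    have hay : a • y = 0 := by
      by_cases hy : y = 0
      · rw [hy, smul_zero]
      · exact (hann y hy a).2 ha
    rw [hay, zero_add, hann x₀ hx₀] at hr
    tauto
  choose r hr hrx using hex
  let g : M → FractionRing (A ⧸ P) := fun y => ι (r y).2 / ι (r y).1
  have hg : ∀ {a b : A} {y : M}, a ∉ P → a • y = b • x₀ → g y = ι b / ι a := by
    intro a b y ha hab
    rw [div_eq_div_iff (hι.not.2 (hr y)) (hι.not.2 ha), ← sub_eq_zero]
    have h1 : ((r y).2 * a - b * (r y).1) • x₀ = 0 := by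
      rw [sub_smul, mul_comm, mul_smul, ← hrx, mul_comm b, mul_smul, ← hab, smul_comm, sub_self]
    rw [hann x₀ hx₀, ← hι] at h1
    simpa [ι] using h1
  have hne : ∀ {a b}, a ∉ P → b ∉ P → a * b ∉ P := fun ha hb hab =>
    (Ideal.IsPrime.mem_or_mem ‹_› hab).elim ha hb
  let f : M →ₗ[A] FractionRing (A ⧸ P) :=
    { toFun := g
      map_add' := by
        intro y z
        have h1 : ((r y).1 * (r z).1) • (y + z) =
            ((r z).1 * (r y).2 + (r y).1 * (r z).2) • x₀ := by
          rw [smul_add, mul_comm, mul_smul, hrx, mul_comm, mul_smul _ _ z, hrx, add_smul,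
            mul_smul, mul_smul]
        rw [hg (hne (hr y) (hr z)) h1]
        have h2 := hι.not.2 (hr y)
        have h3 := hι.not.2 (hr z)
        simp only [g, ι, map_mul, map_add] at h2 h3 ⊢
        field_simp
      map_smul' := by
        intro c y
        have h1 : (r y).1 • (c • y) = (c * (r y).2) • x₀ := by
          rw [smul_comm, hrx, mul_smul]
        rw [hg (hr y) h1, RingHom.id_apply, FractionRing.smul_quotient_eq]
        simp only [g, ι, map_mul, mul_div_assoc] }
  refine ⟨f, (injective_iff_map_eq_zero f).2 fun y hy => ?_⟩
  have h1 : ι (r y).2 = 0 := by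
    have : ι (r y).2 / ι (r y).1 = 0 := hy
    rwa [div_eq_zero_iff, or_iff_left (hι.not.2 (hr y))] at this
  have h2 := hrx y
  rw [(hann x₀ hx₀ _).2 (hι.1 h1)] at h2
  by_contra hy0
  exact hr y ((hann y hy0 _).1 h2)

theorem isTorsionFreeRankOne_iff_exists_submodule {P : Ideal A} [P.IsPrime] :
    IsTorsionFreeRankOne P M ↔
      ∃ N : Submodule A (FractionRing (A ⧸ P)), N ≠ ⊥ ∧ Nonempty (M ≃ₗ[A] N) := by
  constructor
  · intro h
    obtain ⟨f, hf⟩ := h.exists_injective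
    have := (isTorsionFreeRankOne_iff.1 h).1
    obtain ⟨x, hx⟩ := exists_ne (0 : M)
    refine ⟨LinearMap.range f, fun hbot => hx (hf ?_), ⟨LinearEquiv.ofInjective f hf⟩⟩
    rw [map_zero, ← Submodule.mem_bot A, ← hbot]
    exact ⟨x, rfl⟩
  · rintro ⟨N, hN, ⟨e⟩⟩
    have : Nontrivial N := Submodule.nontrivial_iff_ne_bot.2 hN
    have : Nontrivial M := e.toEquiv.nontrivial
    exact isTorsionFreeRankOne_of_injective (N.subtype ∘ₗ e.toLinearMap)
      (N.subtype_injective.comp e.injective)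

theorem IsTorsionFreeRankOne.associatedPrimes_eq [IsNoetherianRing A] {P : Ideal A} [P.IsPrime]
    (h : IsTorsionFreeRankOne P M) : associatedPrimes A M = {P} := by
  obtain ⟨hM, hann, -⟩ := isTorsionFreeRankOne_iff.1 h
  ext Q
  rw [mem_associatedPrimes_iff, Set.mem_singleton_iff]
  constructor
  · rintro ⟨hQ, x, hx⟩
    have hx0 : x ≠ 0 := by
      rintro rfl
      exact hQ.ne_top ((Ideal.eq_top_iff_one _).2 ((hx 1).2 (smul_zero _)))
    ext a
    rw [hx, hann x hx0]
  · rintro rfl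
    obtain ⟨x, hx⟩ := exists_ne (0 : M)
    exact ⟨inferInstance, x, fun a => (hann x hx a).symm⟩

theorem IsTorsionFreeRankOne.annihilator_eq {P : Ideal A} [P.IsPrime]
    (h : IsTorsionFreeRankOne P M) : Module.annihilator A M = P := by
  obtain ⟨hM, hann, -⟩ := isTorsionFreeRankOne_iff.1 h
  ext a
  rw [Module.mem_annihilator]
  constructor
  · intro ha
    obtain ⟨x, hx⟩ := exists_ne (0 : M)
    exact (hann x hx a).1 (ha x)
  · intro ha x
    by_cases hx : x = 0
    · rw [hx, smul_zero]
    · exact (hann x hx a).2 ha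

end RankOne

/-! ### Dedekind quotients: the case of a nonmaximal associated prime. -/

section Dedekind

variable {A : Type u} [CommRing A]

theorem IsDedekindPrime.not_isField {P : Ideal A} (h : IsDedekindPrime P) : ¬ IsField (A ⧸ P) :=
  fun hf => zero_ne_one ((ringKrullDim_eq_zero_of_isField hf).symm.trans h.1)

theorem IsDedekindPrime.not_isMaximal {P : Ideal A} (h : IsDedekindPrime P) : ¬ P.IsMaximal :=
  fun hm => h.not_isField ((Ideal.Quotient.maximal_ideal_iff_isField_quotient P).1 hm)

/-- Localizations of domains at primes are valuation rings as soon as divisibility is total up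
to multiples prime to the prime. -/
theorem valuationRing_localization_iff {D : Type*} [CommRing D] [IsDomain D] (q : Ideal D)
    [q.IsPrime] : ValuationRing (Localization.AtPrime q) ↔
      ∀ a b : D, ∃ s ∉ q, b ∣ s * a ∨ a ∣ s * b := by
  have hinj : Function.Injective (algebraMap D (Localization.AtPrime q)) :=
    IsLocalization.injective _ q.primeCompl_le_nonZeroDivisors
  have key : ∀ a b : D, algebraMap D (Localization.AtPrime q) b ∣ algebraMap D _ a ↔
      ∃ s ∉ q, b ∣ s * a := by
    intro a b
    constructor
    · rintro ⟨z, hz⟩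
      obtain ⟨⟨c, s⟩, hc⟩ := IsLocalization.surj q.primeCompl z
      refine ⟨s, s.2, c, hinj ?_⟩
      rw [map_mul, map_mul, hz, ← hc]
      ring
    · rintro ⟨s, hs, c, hc⟩
      have hu : IsUnit (algebraMap D (Localization.AtPrime q) s) :=
        IsLocalization.map_units _ (⟨s, hs⟩ : q.primeCompl)
      rw [← hu.dvd_mul_left, ← map_mul, hc, map_mul]
      exact dvd_mul_right _ _
  constructor
  · intro h a b
    rcases ValuationRing.dvd_total (algebraMap D (Localization.AtPrime q) b)
      (algebraMap D (Localization.AtPrime q) a) with h | h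
    · obtain ⟨s, hs, h⟩ := (key a b).1 h
      exact ⟨s, hs, Or.inl h⟩
    · obtain ⟨s, hs, h⟩ := (key b a).1 h
      exact ⟨s, hs, Or.inr h⟩
  · intro h
    rw [ValuationRing.iff_dvd_total]
    refine ⟨fun x y => ?_⟩
    obtain ⟨⟨a, s⟩, ha⟩ := IsLocalization.surj q.primeCompl x
    obtain ⟨⟨b, t⟩, hb⟩ := IsLocalization.surj q.primeCompl y
    have hs := IsLocalization.map_units (Localization.AtPrime q) s
    have ht := IsLocalization.map_units (Localization.AtPrime q) t
    have hxy : x ∣ y ↔ ∃ s ∉ q, a ∣ s * b := by rw [← ht.dvd_mul_right, ← hs.mul_right_dvd, ha, hb, key]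
    have hyx : y ∣ x ↔ ∃ s ∉ q, b ∣ s * a := by rw [← hs.dvd_mul_right, ← ht.mul_right_dvd, ha, hb, key]
    obtain ⟨u, hu, h1 | h1⟩ := h a b
    · exact Or.inr (hyx.2 ⟨u, hu, h1⟩)
    · exact Or.inl (hxy.2 ⟨u, hu, h1⟩)

/-- The localization of `A ⧸ P` at the nonzero prime `m ⧸ P` is a discrete valuation ring, so
divisibility is total there; this is its form with denominators cleared and lifted to `A`. -/
theorem IsDedekindPrime.exists_mul_sub_mem {P : Ideal A} [P.IsPrime] (h : IsDedekindPrime P)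
    {m : Ideal A} (hm : m.IsMaximal) (hPm : P ≤ m) (a b : A) :
    ∃ s ∉ m, ∃ c, s * a - c * b ∈ P ∨ s * b - c * a ∈ P := by
  have := h.2
  let q : Ideal (A ⧸ P) := m.map (Ideal.Quotient.mk P)
  have hcomap : q.comap (Ideal.Quotient.mk P) = m := by
    rw [Ideal.comap_map_of_surjective _ Ideal.Quotient.mk_surjective, ← RingHom.ker_eq_comap_bot,
      Ideal.mk_ker, sup_eq_left.2 hPm]
  have hq : q.IsPrime := by
    refine Ideal.map_isPrime_of_surjective Ideal.Quotient.mk_surjective ?_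
    rwa [Ideal.mk_ker]
  have hq0 : q ≠ ⊥ := by
    intro h0
    have hmP : m ≤ P := by
      rwa [Ideal.map_eq_bot_iff_le_ker, Ideal.mk_ker] at h0
    exact h.not_isMaximal (le_antisymm hmP hPm ▸ hm)
  have hdvr := IsLocalization.AtPrime.isDiscreteValuationRing_of_dedekind_domain (A ⧸ P) hq0
    (Localization.AtPrime q)
  obtain ⟨s, hs, hd⟩ := (valuationRing_localization_iff q).1 inferInstance
    (Ideal.Quotient.mk P a) (Ideal.Quotient.mk P b)
  obtain ⟨s, rfl⟩ := Ideal.Quotient.mk_surjective s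
  refine ⟨s, fun h' => hs (Ideal.mem_map_of_mem _ h'), ?_⟩
  have key : ∀ a b : A, Ideal.Quotient.mk P b ∣ Ideal.Quotient.mk P s * Ideal.Quotient.mk P a →
      ∃ c, s * a - c * b ∈ P := by
    rintro a b ⟨c, hc⟩
    obtain ⟨c, rfl⟩ := Ideal.Quotient.mk_surjective c
    refine ⟨c, Ideal.Quotient.eq.1 ?_⟩
    rw [map_mul, map_mul, hc, mul_comm]
  rcases hd with hd | hd
  · obtain ⟨c, hc⟩ := key a b hd
    exact ⟨c, Or.inl hc⟩
  · obtain ⟨c, hc⟩ := key b a hd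
    exact ⟨c, Or.inr hc⟩

/-- A noetherian local domain that is a valuation ring and not a field is a discrete valuation ring.
For a nonzero prime `q`, any maximal ideal above it supplies the multiplier, as `s ∉ m` gives `s ∉
q`. -/
theorem isDedekindPrime_of_exists_mul_sub_mem [IsNoetherianRing A] {P : Ideal A} [P.IsPrime]
    (hP : ¬ P.IsMaximal) (h : ∀ m : Ideal A, m.IsMaximal → P ≤ m → ∀ a b : A,
      ∃ s ∉ m, ∃ c, s * a - c * b ∈ P ∨ s * b - c * a ∈ P) : IsDedekindPrime P := by
  have hnf : ¬ IsField (A ⧸ P) := fun hf => hP (Ideal.Quotient.maximal_of_isField _ hf)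
  have hdvr : IsDedekindDomainDvr (A ⧸ P) := by
    refine ⟨fun q hq0 hq => ?_⟩
    refine ((IsDiscreteValuationRing.TFAE (Localization.AtPrime q)
      (IsLocalization.AtPrime.not_isField (A ⧸ P) hq0 _)).out 0 1).2 ?_
    rw [valuationRing_localization_iff]
    intro a b
    obtain ⟨a, rfl⟩ := Ideal.Quotient.mk_surjective a
    obtain ⟨b, rfl⟩ := Ideal.Quotient.mk_surjective b
    obtain ⟨m, hm, hqm⟩ := Ideal.exists_le_maximal _
      (hq.comap (Ideal.Quotient.mk P)).ne_top
    have hPm : P ≤ m := by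
      refine le_trans (fun a ha => ?_) hqm
      rw [Ideal.mem_comap, Ideal.Quotient.eq_zero_iff_mem.2 ha]
      exact q.zero_mem
    obtain ⟨s, hs, c, hc⟩ := h m hm hPm a b
    refine ⟨Ideal.Quotient.mk P s, fun h' => hs (hqm h'), hc.imp (fun hc => ?_) fun hc => ?_⟩ <;>
    · rw [← Ideal.Quotient.eq, map_mul, map_mul] at hc
      exact ⟨_, hc.trans (mul_comm _ _)⟩
  have hded := IsDedekindDomainDvr.isDedekindDomain (A ⧸ P)
  refine ⟨le_antisymm ?_ ?_, hded⟩
  · rw [← Nat.cast_one, ← Ring.krullDimLE_iff]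
    exact Ring.KrullDimLE.mk₁' fun I hI hI' => hI'.isMaximal hI
  · by_contra! h1
    have h2 : ringKrullDim (A ⧸ P) ≤ (0 : ℕ) := Order.le_of_lt_succ h1
    rw [← Ring.krullDimLE_iff] at h2
    exact hnf Ring.KrullDimLE.isField_of_isDomain

variable {M : Type v} [AddCommGroup M] [Module A M]

theorem IsDedekindRankOne.isMeager {P : Ideal A} [P.IsPrime] (h : IsDedekindRankOne P M) :
    IsMeager A M := by
  obtain ⟨hM, hann, hrel⟩ := isTorsionFreeRankOne_iff.1 h.2
  have htors : ∀ a ∈ P, ∀ x : M, a • x = 0 := fun a ha x => by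
    by_cases hx : x = 0
    · rw [hx, smul_zero]
    · exact (hann x hx a).2 ha
  rw [isMeager_iff]
  intro m hm x y
  by_cases hPm : P ≤ m
  swap
  · obtain ⟨s, hs, hsm⟩ := Set.not_subset.1 hPm
    exact ⟨s, 0, Or.inl hsm, by rw [htors s hs, zero_smul, zero_add]⟩
  -- A nontrivial relation over `A ⧸ P` is made nontrivial modulo `m`: once `s a ≡ c b` modulo `P`,
  -- it becomes `b (s y + c x) = 0`, and `b` cancels by torsion-freeness.
  have key : ∀ {x y : M} {a b s c : A}, (a ∉ P ∨ b ∉ P) → a • x + b • y = 0 → s ∉ m →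
      s * a - c * b ∈ P → s • y + c • x = 0 := by
    intro x y a b s c hab hr hs hc
    have hb : b ∉ P := by
      intro hb
      have : s * a ∈ P := by simpa using add_mem hc (P.mul_mem_left c hb)
      rcases Ideal.IsPrime.mem_or_mem ‹_› this with h' | h'
      · exact hs (hPm h')
      · tauto
    have h1 : b • (s • y + c • x) = 0 := by
      have h2 : b • (s • y + c • x) = s • (a • x + b • y) - (s * a - c * b) • x := by module
      rw [h2, hr, htors _ hc, smul_zero, sub_zero]
    by_contra hne
    exact hb ((hann _ hne b).1 h1)
  obtain ⟨a, b, hab, hr⟩ := hrel x y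
  obtain ⟨s, hs, c, hc | hc⟩ := h.1.exists_mul_sub_mem hm hPm a b
  · exact ⟨c, s, Or.inr hs, by rw [add_comm]; exact key hab hr hs hc⟩
  · exact ⟨s, c, Or.inl hs, key hab.symm (by rwa [add_comm]) hs hc⟩

theorem IsDedekindRankOne.not_isArtinian [IsNoetherianRing A] {P : Ideal A} [P.IsPrime]
    (h : IsDedekindRankOne P M) : ¬ IsArtinian A M := by
  intro _
  refine h.1.not_isMaximal (isMaximal_of_mem_associatedPrimes (M := M) ?_)
  rw [h.2.associatedPrimes_eq]
  rfl

theorem IsMeager.isDedekindRankOne [IsNoetherianRing A] {P : Ideal A} [hp : P.IsPrime]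
    (h : IsMeager A M) (hM : associatedPrimes A M = {P}) (hP : ¬ P.IsMaximal) :
    IsDedekindRankOne P M := by
  have hann : ∀ x : M, x ≠ 0 → ∀ a : A, a • x = 0 → a ∈ P := by
    intro x hx a ha
    obtain ⟨Q, hQ, hle⟩ := exists_le_isAssociatedPrime_of_isNoetherianRing A x hx
    have hQP : Q = P := by
      rw [← Set.mem_singleton_iff, ← hM]; exact hQ
    exact hQP ▸ hle (by simpa [Submodule.mem_colon_singleton] using ha)
  obtain ⟨-, x₀, hx₀⟩ : P.IsPrime ∧ ∃ x : M, ∀ a, a ∈ P ↔ a • x = 0 :=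
    mem_associatedPrimes_iff.1 (by rw [hM]; rfl)
  rw [isMeager_iff] at h
  -- Nakayama for `N = P x`: the criterion for `q x` and `t x`, with `t ∈ m` outside `P`, forces `b
  -- ∈ P` and hence `a ∉ m`, so `q x` lies in `m N`. Some `r ≡ 1` modulo `m` then kills `N`, but
  -- annihilators of nonzero elements lie in `P ≤ m`.
  have hkill : ∀ p ∈ P, ∀ x : M, p • x = 0 := by
    intro p hpP x
    obtain ⟨m, hm, hPm⟩ := Ideal.exists_le_maximal P hp.ne_top
    obtain ⟨t, htm, htP⟩ := Set.not_subset.1 fun h' : m ≤ P => hP (le_antisymm hPm h' ▸ hm)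
    let N : Submodule A M := P • Submodule.span A {x}
    have hNfg : N.FG := Submodule.FG.smul (IsNoetherian.noetherian P)
      (Submodule.fg_span_singleton x)
    have hmem : ∀ c ∈ P, c • x ∈ N := fun c hc =>
      Submodule.smul_mem_smul hc (Submodule.mem_span_singleton_self x)
    have hle : ∀ q ∈ P, q • x ∈ m • N := by
      intro q hqr
      obtain ⟨a, b, hab, hr⟩ := h m hm (q • x) (t • x)
      by_cases hqx : q • x = 0
      · rw [hqx]; exact zero_mem _
      have hx : x ≠ 0 := by rintro rfl; exact hqx (smul_zero _)
      have hbP : b ∈ P := by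
        have h1 : a * q + b * t ∈ P := hann x hx _ (by rw [add_smul, mul_smul, mul_smul, hr])
        have h2 : b * t ∈ P := by simpa using sub_mem h1 (P.mul_mem_left a hqr)
        exact (hp.mem_or_mem h2).resolve_right htP
      have ha : a ∉ m := hab.resolve_right (not_not.2 (hPm hbP))
      obtain ⟨c, hc⟩ := exists_mul_sub_one_mem_pow hm ha 1
      rw [pow_one] at hc
      have h3 : q • x = (1 - c * a) • (q • x) + (- c * t) • (b • x) := by
        have h4 : (1 - c * a) • (q • x) + (- c * t) • (b • x) =
            q • x - c • (a • q • x + b • t • x) := by module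
        rw [h4, hr, smul_zero, sub_zero]
      rw [h3]
      exact add_mem (Submodule.smul_mem_smul hc (hmem q hqr))
        (Submodule.smul_mem_smul (m.mul_mem_left _ htm) (hmem b hbP))
    obtain ⟨r, hr, hrN⟩ := Submodule.exists_sub_one_mem_and_smul_eq_zero_of_fg_of_le_smul m N
      hNfg (Submodule.smul_le.2 fun q hq y hy => by
        obtain ⟨r, rfl⟩ := Submodule.mem_span_singleton.1 hy
        rw [smul_smul q r x]
        exact hle _ (P.mul_mem_right r hq))
    by_contra hpx
    have hrP := hann _ hpx r (hrN _ (hmem p hpP))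
    exact hm.ne_top ((Ideal.eq_top_iff_one m).2 (by simpa using sub_mem (hPm hrP) hr))
  refine ⟨isDedekindPrime_of_exists_mul_sub_mem hP fun m hm hPm a b => ?_,
    isTorsionFreeRankOne_iff.2 ⟨⟨x₀, 0, ?_⟩, fun x hx a => ⟨hann x hx a, fun ha => hkill a ha x⟩,
      fun x y => ?_⟩⟩
  · obtain ⟨u, v, huv, hr⟩ := h m hm (a • x₀) (b • x₀)
    rw [← mul_smul, ← mul_smul, ← add_smul, ← hx₀] at hr
    rcases huv with hu | hv
    · exact ⟨u, hu, -v, Or.inl (by rwa [neg_mul, sub_neg_eq_add])⟩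
    · exact ⟨v, hv, -u, Or.inr (by rwa [neg_mul, sub_neg_eq_add, add_comm])⟩
  · rintro rfl
    exact hp.ne_top ((Ideal.eq_top_iff_one P).2 ((hx₀ 1).2 (smul_zero _)))
  · obtain ⟨m, hm, hPm⟩ := Ideal.exists_le_maximal P hp.ne_top
    obtain ⟨a, b, hab, hr⟩ := h m hm x y
    exact ⟨a, b, hab.imp (fun h' ha => h' (hPm ha)) (fun h' hb => h' (hPm hb)), hr⟩

theorem IsDedekindPrime.quotient {P : Ideal A} [P.IsPrime] (h : IsDedekindPrime P) :
    IsDedekindRankOne P (A ⧸ P) :=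
  ⟨h, isTorsionFreeRankOne_of_injective
    (IsScalarTower.toAlgHom A (A ⧸ P) (FractionRing (A ⧸ P))).toLinearMap
    (IsFractionRing.injective (A ⧸ P) (FractionRing (A ⧸ P)))⟩

theorem IsDedekindPrime.fractionRing {P : Ideal A} [P.IsPrime] (h : IsDedekindPrime P) :
    IsDedekindRankOne P (FractionRing (A ⧸ P)) :=
  ⟨h, isTorsionFreeRankOne_of_injective LinearMap.id Function.injective_id⟩

theorem IsDedekindPrime.not_finite_fractionRing {P : Ideal A} [P.IsPrime]
    (h : IsDedekindPrime P) : ¬ Module.Finite A (FractionRing (A ⧸ P)) := by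
  intro _
  have : Module.Finite (A ⧸ P) (FractionRing (A ⧸ P)) :=
    Module.Finite.of_restrictScalars_finite A _ _
  exact h.not_isField (isField_of_isIntegral_of_isField
    (IsFractionRing.injective (A ⧸ P) (FractionRing (A ⧸ P))) (Field.toIsField _))

end Dedekind

/-! ### The completed local ring and its action on primary modules. -/

noncomputable section Completion

variable {A : Type u} [CommRing A]

namespace CompletedLocalization

variable {P : Ideal A} [P.IsMaximal]

variable (P) in
/-- The projection from the completed local ring to `A ⧸ P ^ n`. -/
def proj (n : ℕ) : CompletedLocalization P →ₐ[A] A ⧸ P ^ n :=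
  (IsLocalization.AtPrime.equivQuotMaximalIdealPow P (Localization.AtPrime P) n).symm.toAlgHom.comp
    ((AdicCompletion.evalₐ (IsLocalRing.maximalIdeal (Localization.AtPrime P)) n).restrictScalars A)

theorem proj_algebraMap (n : ℕ) (a : A) :
    proj P n (algebraMap A _ a) = Ideal.Quotient.mk (P ^ n) a :=
  (proj P n).commutes a

theorem proj_eq_mk_iff {n : ℕ} {c : CompletedLocalization P} {a : A} :
    proj P n c = Ideal.Quotient.mk (P ^ n) a ↔
      AdicCompletion.evalₐ (IsLocalRing.maximalIdeal (Localization.AtPrime P)) n c =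
        Ideal.Quotient.mk _ (algebraMap A (Localization.AtPrime P) a) := by
  rw [← IsLocalization.AtPrime.equivQuotMaximalIdealPow_apply_mk P]
  exact AlgEquiv.symm_apply_eq
    (IsLocalization.AtPrime.equivQuotMaximalIdealPow P (Localization.AtPrime P) n)

theorem proj_eq_mk_of_le {m n : ℕ} (h : m ≤ n) {c : CompletedLocalization P} {a : A}
    (hc : proj P n c = Ideal.Quotient.mk (P ^ n) a) :
    proj P m c = Ideal.Quotient.mk (P ^ m) a := by
  rw [proj_eq_mk_iff] at hc ⊢
  obtain ⟨f, rfl⟩ := AdicCompletion.mk_surjective _ _ c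
  rw [AdicCompletion.evalₐ_mk] at hc ⊢
  rw [← AdicCompletion.Ideal.mk_eq_mk _ h f]
  rw [Ideal.Quotient.eq] at hc ⊢
  exact Ideal.pow_le_pow_right h hc

theorem map_algebraMap_eq (n : ℕ) :
    (IsLocalRing.maximalIdeal (Localization.AtPrime P) ^ n).map
      (algebraMap (Localization.AtPrime P) (CompletedLocalization P)) =
        (P ^ n).map (algebraMap A (CompletedLocalization P)) := by
  have h : ∀ J : Ideal (Localization.AtPrime P), J = (P ^ n).map (algebraMap A _) →
      J.map (algebraMap (Localization.AtPrime P) (CompletedLocalization P)) =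
        (P ^ n).map (algebraMap A (CompletedLocalization P)) := by
    rintro _ rfl
    rw [Ideal.map_map, ← IsScalarTower.algebraMap_eq]
  exact h _ (by rw [Ideal.map_pow, Localization.AtPrime.map_eq_maximalIdeal])

/-- Completeness: a sequence that is Cauchy for the powers of `P` has a limit. -/
theorem exists_proj_eq (b : ℕ → A) (hb : ∀ n, b (n + 1) - b n ∈ P ^ n) :
    ∃ c : CompletedLocalization P, ∀ n, proj P n c = Ideal.Quotient.mk (P ^ n) (b n) := by
  let f : AdicCompletion.AdicCauchySequence
      (IsLocalRing.maximalIdeal (Localization.AtPrime P)) (Localization.AtPrime P) :=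
    AdicCompletion.AdicCauchySequence.mk _ _ (fun n => algebraMap A _ (b n)) fun n => by
      rw [SModEq.comm, SModEq.sub_mem, ← map_sub, ← Localization.AtPrime.map_eq_maximalIdeal,
        ← Ideal.map_pow, smul_eq_mul, Ideal.mul_top]
      exact Ideal.mem_map_of_mem _ (hb n)
  refine ⟨AdicCompletion.mk _ _ f, fun n => ?_⟩
  rw [proj_eq_mk_iff, AdicCompletion.evalₐ_mk]
  rfl

variable [IsNoetherianRing A]

/-- Since the maximal ideal is finitely generated, the kernel of evaluation at level `n` is the
extension of its `n`-th power, not just a closure of it. -/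
theorem mem_map_pow_of_proj_eq_zero {n : ℕ} {c : CompletedLocalization P}
    (hc : proj P n c = 0) : c ∈ (P ^ n).map (algebraMap A (CompletedLocalization P)) := by
  rw [← map_zero (Ideal.Quotient.mk (P ^ n)), proj_eq_mk_iff, map_zero, map_zero] at hc
  have h1 : c ∈ (AdicCompletion.eval (IsLocalRing.maximalIdeal (Localization.AtPrime P))
      (Localization.AtPrime P) n).ker := by
    have h2 := AdicCompletion.factor_evalₐ_eq_eval
      (IsLocalRing.maximalIdeal (Localization.AtPrime P)) (n := n) c (by simp)
    rw [hc, map_zero] at h2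
    exact h2.symm
  rw [← AdicCompletion.pow_smul_top_eq_ker_eval (IsNoetherian.noetherian _),
    Ideal.smul_top_eq_map] at h1
  rw [← map_algebraMap_eq]
  exact h1

theorem algebraMap_mem_maximalIdeal {p : A} (hp : p ∈ P) :
    algebraMap A (CompletedLocalization P) p ∈
      IsLocalRing.maximalIdeal (CompletedLocalization P) := by
  have h := map_algebraMap_eq (P := P) 1
  rw [pow_one, pow_one] at h
  rw [AdicCompletion.maximalIdeal_eq_map]
  exact h ▸ Ideal.mem_map_of_mem _ hp

/-- The difference of `c` and `a` lies in the extension of `P ^ n`, which kills `x`. So any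
compatible action of the completed ring is determined by the action of `A`. -/
theorem smul_eq_smul {M : Type*} [AddCommGroup M] [Module A M]
    [Module (CompletedLocalization P) M] [IsScalarTower A (CompletedLocalization P) M]
    {n : ℕ} {x : M} (hx : ∀ a ∈ P ^ n, a • x = 0) {c : CompletedLocalization P} {a : A}
    (hc : proj P n c = Ideal.Quotient.mk (P ^ n) a) : c • x = a • x := by
  have h1 : c - algebraMap A _ a ∈ (P ^ n).map (algebraMap A (CompletedLocalization P)) := by
    refine mem_map_pow_of_proj_eq_zero ?_
    rw [map_sub, hc, proj_algebraMap, sub_self]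
  have h2 : (P ^ n).map (algebraMap A (CompletedLocalization P)) ≤
      Ideal.torsionOf (CompletedLocalization P) M x := by
    rw [Ideal.map_le_iff_le_comap]
    intro b hb
    rw [Ideal.mem_comap, Ideal.mem_torsionOf_iff, algebraMap_smul, hx b hb]
  have h3 := h2 h1
  rw [Ideal.mem_torsionOf_iff, sub_smul, algebraMap_smul, sub_eq_zero] at h3
  exact h3

end CompletedLocalization

open CompletedLocalization

theorem exists_pow_smul_of_primaryPart_eq_top {P : Ideal A} {M : Type*} [AddCommGroup M]
    [Module A M] (hM : primaryPart P M = ⊤) (x : M) : ∃ n : ℕ, ∀ a ∈ P ^ n, a • x = 0 := by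
  obtain ⟨n, -, hn⟩ : x ∈ primaryPart P M := by rw [hM]; trivial
  exact ⟨n, hn⟩

theorem exists_proj_eq_and_pow_smul {P : Ideal A} [P.IsMaximal] {M : Type*} [AddCommGroup M]
    [Module A M] (hM : primaryPart P M = ⊤) (c : CompletedLocalization P) (x : M) :
    ∃ (n : ℕ) (a : A), (∀ b ∈ P ^ n, b • x = 0) ∧ proj P n c = Ideal.Quotient.mk (P ^ n) a := by
  obtain ⟨n, hn⟩ := exists_pow_smul_of_primaryPart_eq_top hM x
  obtain ⟨a, ha⟩ := Ideal.Quotient.mk_surjective (proj P n c)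
  exact ⟨n, a, hn, ha.symm⟩

/-- A `P`-primary module is a module over the completed local ring at the maximal ideal `P`. -/
theorem exists_module_completedLocalization {P : Ideal A} [P.IsMaximal] {M : Type*}
    [AddCommGroup M] [Module A M] (hM : primaryPart P M = ⊤) :
    ∃ _ : Module (CompletedLocalization P) M, IsScalarTower A (CompletedLocalization P) M := by
  choose n r hn hr using fun (c : CompletedLocalization P) (x : M) =>
    exists_proj_eq_and_pow_smul hM c x
  -- The action of `c` on `x` through a representative modulo a power of `P` killing `x` is
  -- independent of the power and of the representative: compare both at the larger level.
  have key : ∀ {c : CompletedLocalization P} {x : M} {m : ℕ} {a : A},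
      (∀ b ∈ P ^ m, b • x = 0) → proj P m c = Ideal.Quotient.mk (P ^ m) a → r c x • x = a • x := by
    intro c x m a hm ha
    obtain ⟨b, hb⟩ := Ideal.Quotient.mk_surjective (proj P (max m (n c x)) c)
    have h1 := proj_eq_mk_of_le (le_max_left m (n c x)) hb.symm
    have h2 := proj_eq_mk_of_le (le_max_right m (n c x)) hb.symm
    rw [ha, Ideal.Quotient.eq] at h1
    rw [hr, Ideal.Quotient.eq] at h2
    have h3 := hm _ h1
    have h4 := hn c x _ h2
    rw [sub_smul, sub_eq_zero] at h3 h4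
    rw [h3, h4]
  have hmax : ∀ {m k : ℕ} {x : M}, (∀ b ∈ P ^ m, b • x = 0) → m ≤ k → ∀ b ∈ P ^ k, b • x = 0 :=
    fun h hmk b hb => h b (Ideal.pow_le_pow_right hmk hb)
  let _ : Module (CompletedLocalization P) M :=
    { smul := fun c x => r c x • x
      one_smul := fun x => by
        refine (key (a := 1) (hn 1 x) ?_).trans (one_smul _ _)
        rw [map_one, map_one]
      mul_smul := fun c d x => by
        have h1 : ∀ b ∈ P ^ n d x, b • (r d x • x) = 0 := fun b hb => by
          rw [smul_comm, hn d x b hb, smul_zero]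
        obtain ⟨a, ha⟩ := Ideal.Quotient.mk_surjective (proj P (n d x) c)
        refine (key (a := a * r d x) (hn d x) ?_).trans ?_
        · rw [map_mul, map_mul, ha, hr d x]
        · rw [mul_smul]
          exact (key h1 ha.symm).symm
      smul_zero := fun c => smul_zero _
      smul_add := fun c x y => by
        have hx := hmax (hn c x) (le_max_left _ (n c y))
        have hy := hmax (hn c y) (le_max_right (n c x) _)
        obtain ⟨a, ha⟩ := Ideal.Quotient.mk_surjective (proj P (max (n c x) (n c y)) c)
        have hxy : ∀ b ∈ P ^ max (n c x) (n c y), b • (x + y) = 0 := fun b hb => by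
          rw [smul_add, hx b hb, hy b hb, add_zero]
        exact (key hxy ha.symm).trans ((smul_add _ _ _).trans
          (congrArg₂ _ (key hx ha.symm).symm (key hy ha.symm).symm))
      add_smul := fun c d x => by
        have hx := hmax (hn c x) (le_max_left _ (n d x))
        obtain ⟨a, ha⟩ := Ideal.Quotient.mk_surjective (proj P (max (n c x) (n d x)) c)
        obtain ⟨b, hb⟩ := Ideal.Quotient.mk_surjective (proj P (max (n c x) (n d x)) d)
        refine (key (a := a + b) hx (by rw [map_add, map_add, ha, hb])).trans
          ((add_smul _ _ _).trans (congrArg₂ _ (key hx ha.symm).symm (key hx hb.symm).symm))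
      zero_smul := fun x => by
        refine (key (a := 0) (hn 0 x) ?_).trans (zero_smul _ _)
        rw [map_zero, map_zero] }
  refine ⟨inferInstance, IsScalarTower.of_algebraMap_smul fun a x => ?_⟩
  exact key (hn (algebraMap A _ a) x) (proj_algebraMap _ _)

end Completion

/-! ### Uniserial modules of infinite length and division sequences. -/

section Divisible

variable {A : Type u} [CommRing A] {M : Type v} [AddCommGroup M] [Module A M]

theorem associatedPrimes_eq_of_primaryPart_eq_top [IsNoetherianRing A] [Nontrivial M] {P : Ideal A}
    (hP : P.IsMaximal) (hM : primaryPart P M = ⊤) : associatedPrimes A M = {P} := by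
  have key : ∀ Q ∈ associatedPrimes A M, Q = P := by
    intro Q hQ
    obtain ⟨hQp, x, hx⟩ := mem_associatedPrimes_iff.1 hQ
    obtain ⟨n, hn⟩ := exists_pow_smul_of_primaryPart_eq_top hM x
    exact (hP.eq_of_le hQp.ne_top (hQp.le_of_pow_le fun a ha => (hx a).2 (hn a ha))).symm
  obtain ⟨Q, hQ⟩ := associatedPrimes.nonempty A M
  exact Set.eq_singleton_iff_unique_mem.2 ⟨key Q hQ ▸ hQ, key⟩

/-- The socle of a uniserial module is generated by any of its nonzero elements, and is contained
in every nonzero submodule. -/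
theorem IsUniserial.exists_eq_smul {P : Ideal A} (hP : P.IsMaximal) (h : IsUniserial A M)
    {x z : M} (hx : x ≠ 0) (hz : ∀ p ∈ P, p • z = 0) : ∃ c : A, z = c • x := by
  rcases h z x with h | ⟨a, rfl⟩
  · exact h
  · have ha : a ∉ P := fun ha => hx (hz a ha)
    obtain ⟨b, hb⟩ := exists_mul_sub_one_mem_pow hP ha 1
    rw [pow_one] at hb
    refine ⟨b, ?_⟩
    have := hz _ hb
    rwa [sub_smul, one_smul, mul_smul, sub_eq_zero] at this

/-- Take `t ∈ P` with minimal kernel; as submodules form a chain, its kernel is the socle. Were `t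
M` proper, it would lie in a cyclic module; the kernel does too, so `M` would be noetherian, hence
of finite length. -/
theorem IsUniserial.exists_surjective_smul [IsNoetherianRing A] {P : Ideal A} (hP : P.IsMaximal)
    (hM : primaryPart P M = ⊤) (h : IsUniserial A M) (hfl : ¬ IsFiniteLength A M) :
    ∃ t ∈ P, (∀ x : M, ∃ y : M, t • y = x) ∧ ∀ x : M, t • x = 0 → ∀ p ∈ P, p • x = 0 := by
  have hart := h.isArtinian hP hM
  obtain ⟨_, ⟨t, htP, rfl⟩, hmin⟩ := IsArtinian.set_has_minimal
    ((fun p : A => LinearMap.ker (LinearMap.lsmul A M p)) '' (P : Set A)) ⟨_, 0, P.zero_mem, rfl⟩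
  have ht : ∀ x : M, t • x = 0 → ∀ p ∈ P, p • x = 0 := by
    intro x hx p hp
    by_contra hpx
    refine hmin _ ⟨p, hp, rfl⟩ (lt_of_le_not_ge ?_ fun h' => hpx (h' hx))
    exact (isUniserial_iff.1 h _ _).resolve_right fun h' => hpx (h' hx)
  refine ⟨t, htP, ?_, ht⟩
  by_contra! hsurj
  obtain ⟨y, hy⟩ := hsurj
  refine hfl (isFiniteLength_iff_isNoetherian_isArtinian.2 ⟨?_, hart⟩)
  have hnt : ∃ x : M, x ≠ 0 := ⟨y, fun h0 => hy 0 (by rw [h0, smul_zero])⟩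
  obtain ⟨x, hx⟩ := hnt
  have h1 : IsNoetherian A (LinearMap.ker (LinearMap.lsmul A M t)) := by
    have hle : LinearMap.ker (LinearMap.lsmul A M t) ≤ Submodule.span A {x} := fun z hz => by
      obtain ⟨c, rfl⟩ := h.exists_eq_smul hP hx (ht z hz)
      exact Submodule.smul_mem _ _ (Submodule.mem_span_singleton_self x)
    exact isNoetherian_of_le hle
  have h2 : IsNoetherian A (LinearMap.range (LinearMap.lsmul A M t)) :=
    isNoetherian_of_le (h.le_span_singleton (x := y) fun ⟨z, hz⟩ => hy z hz)
  exact isNoetherian_of_range_eq_ker (LinearMap.ker (LinearMap.lsmul A M t)).subtype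
    (LinearMap.lsmul A M t).rangeRestrict (by simp)

/-- A sequence of elements `x 0 = 0`, `x 1 ≠ 0` of `M` such that `t • x (k + 1) = x k`. -/
structure IsDivisionSequence (t : A) (x : ℕ → M) : Prop where
  zero : x 0 = 0
  one_ne : x 1 ≠ 0
  smul_succ : ∀ k, t • x (k + 1) = x k

theorem exists_isDivisionSequence {t : A} (ht : ∀ x : M, ∃ y : M, t • y = x)
    (h : ∃ x : M, x ≠ 0 ∧ t • x = 0) : ∃ x : ℕ → M, IsDivisionSequence t x := by
  choose s hs using ht
  obtain ⟨x, hx, htx⟩ := h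
  -- The extra factor `t` shifts the index: the terms are `t x = 0`, then `x`, then successive
  -- quotients of `x` by `t`.
  refine ⟨fun k => t • s^[k] x, by simpa using htx, by simpa [hs] using hx, fun k => ?_⟩
  rw [Function.iterate_succ_apply', hs]

namespace IsDivisionSequence

variable {t : A} {x : ℕ → M}

theorem pow_smul_add (hx : IsDivisionSequence t x) (k n : ℕ) : t ^ n • x (k + n) = x k := by
  induction n with
  | zero => simp
  | succ n ih => rw [pow_succ, mul_smul, ← add_assoc, hx.smul_succ, ih]

theorem pow_smul_ne_zero (hx : IsDivisionSequence t x) {n k : ℕ} (h : k < n) :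
    t ^ k • x n ≠ 0 := by
  obtain ⟨d, rfl⟩ := Nat.exists_eq_add_of_lt h
  intro h0
  refine hx.one_ne ?_
  rw [← hx.pow_smul_add 1 (k + d), pow_add, mul_comm, mul_smul, show 1 + (k + d) = k + d + 1 by ring,
    h0, smul_zero]

variable {P : Ideal A}

/-- Inductively `t z` is a multiple of `x k = t x (k + 1)`; the remaining error lies in the socle,
which `x 1 = tᵏ x (k + 1)` generates. -/
theorem exists_eq_smul (hP : P.IsMaximal) (h : IsUniserial A M)
    (hker : ∀ x : M, t • x = 0 → ∀ p ∈ P, p • x = 0) (hx : IsDivisionSequence t x) {k : ℕ} :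
    ∀ {z : M}, t ^ k • z = 0 → ∃ c : A, z = c • x k := by
  induction k with
  | zero =>
    intro z hz
    rw [pow_zero, one_smul] at hz
    exact ⟨0, by rw [hz, zero_smul]⟩
  | succ k ih =>
    intro z hz
    rw [pow_succ, mul_smul] at hz
    obtain ⟨c, hc⟩ := ih hz
    have h1 : t • (z - c • x (k + 1)) = 0 := by
      rw [smul_sub, hc, smul_comm, hx.smul_succ, sub_self]
    obtain ⟨d, hd⟩ := h.exists_eq_smul hP hx.one_ne (hker _ h1)
    refine ⟨c + d * t ^ k, ?_⟩
    rw [add_smul, mul_smul, add_comm k 1, hx.pow_smul_add, ← hd, add_comm 1 k, add_sub_cancel]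

theorem smul_eq_zero_of_mem_pow (hP : P.IsMaximal) (h : IsUniserial A M)
    (hker : ∀ x : M, t • x = 0 → ∀ p ∈ P, p • x = 0) (hx : IsDivisionSequence t x) (k : ℕ) :
    ∀ a ∈ P ^ k, a • x k = 0 := by
  induction k with
  | zero => simp [hx.zero]
  | succ k ih =>
    intro a ha
    rw [pow_succ] at ha
    induction ha using Submodule.mul_induction_on' with
    | mem_mul_mem b hb c hc =>
      have h1 : t ^ k • (c • x (k + 1)) = 0 := by
        rw [smul_comm, add_comm, hx.pow_smul_add]
        exact hker _ (by simpa [hx.zero] using hx.smul_succ 0) c hc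
      obtain ⟨d, hd⟩ := hx.exists_eq_smul hP h hker h1
      rw [mul_smul, hd, smul_comm, ih b hb, smul_zero]
    | add b _ c _ hb hc => rw [add_smul, hb, hc, add_zero]

theorem exists_eq_smul_of_primaryPart (hP : P.IsMaximal) (hM : primaryPart P M = ⊤)
    (h : IsUniserial A M) (htP : t ∈ P)
    (hker : ∀ x : M, t • x = 0 → ∀ p ∈ P, p • x = 0) (hx : IsDivisionSequence t x) (z : M) :
    ∃ (n : ℕ) (c : A), z = c • x n := by
  obtain ⟨n, hn⟩ := exists_pow_smul_of_primaryPart_eq_top hM z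
  exact ⟨n, hx.exists_eq_smul hP h hker (hn _ (Ideal.pow_mem_pow htP n))⟩

end IsDivisionSequence

/-- The data of an infinite uniserial `P`-primary module: multiplication by `t` is
surjective on it, with the socle as its kernel, and `x` is a division sequence. -/
structure IsDivisibleUniserial (P : Ideal A) (t : A) (x : ℕ → M) : Prop where
  isUniserial : IsUniserial A M
  primaryPart_eq_top : primaryPart P M = ⊤
  mem : t ∈ P
  smul_eq_zero : ∀ x : M, t • x = 0 → ∀ p ∈ P, p • x = 0
  seq : IsDivisionSequence t x

theorem IsUniserial.exists_isDivisibleUniserial [IsNoetherianRing A] {P : Ideal A}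
    (hP : P.IsMaximal) (hM : primaryPart P M = ⊤) (h : IsUniserial A M)
    (hfl : ¬ IsFiniteLength A M) : ∃ (t : A) (x : ℕ → M), IsDivisibleUniserial P t x := by
  obtain ⟨t, htP, hsurj, hker⟩ := h.exists_surjective_smul hP hM hfl
  have : Nontrivial M := by
    by_contra hM
    rw [not_nontrivial_iff_subsingleton] at hM
    exact hfl IsFiniteLength.of_subsingleton
  have hass : P ∈ associatedPrimes A M := by
    rw [associatedPrimes_eq_of_primaryPart_eq_top hP hM]; rfl
  obtain ⟨-, y, hy⟩ := mem_associatedPrimes_iff.1 hass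
  have hy0 : y ≠ 0 := by
    rintro rfl
    exact hP.ne_top ((Ideal.eq_top_iff_one P).2 ((hy 1).2 (smul_zero _)))
  obtain ⟨x, hx⟩ := exists_isDivisionSequence hsurj ⟨y, hy0, (hy t).1 htP⟩
  exact ⟨t, x, h, hM, htP, hker, hx⟩

namespace IsDivisibleUniserial

open CompletedLocalization

variable [IsNoetherianRing A] {P : Ideal A} [hP : P.IsMaximal] {t : A} {x : ℕ → M}
  [Module (CompletedLocalization P) M] [IsScalarTower A (CompletedLocalization P) M]

omit [IsNoetherianRing A] [Module (CompletedLocalization P) M]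
  [IsScalarTower A (CompletedLocalization P) M] in
theorem exists_eq_smul (h : IsDivisibleUniserial P t x) (z : M) :
    ∃ (n : ℕ) (c : A), z = c • x n :=
  h.seq.exists_eq_smul_of_primaryPart hP h.primaryPart_eq_top h.isUniserial h.mem h.smul_eq_zero z

/-- Each `y k` is `b k • x k`. Two successive coefficients differ by a socle correction `d * t ^ k`,
so the `b k` form a Cauchy sequence, with limit `u`. -/
theorem exists_smul_eq (h : IsDivisibleUniserial P t x) {y : ℕ → M} (hy0 : y 0 = 0)
    (hy : ∀ k, t • y (k + 1) = y k) :
    ∃ u : CompletedLocalization P, ∀ k, u • x k = y k := by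
  have hyk : ∀ k, t ^ k • y k = 0 := by
    intro k
    induction k with
    | zero => simp [hy0]
    | succ k ih => rw [pow_succ, mul_smul, hy, ih]
  have step : ∀ (k : ℕ) (b : A), b • x k = y k →
      ∃ b' : A, b' • x (k + 1) = y (k + 1) ∧ b' - b ∈ P ^ k := by
    intro k b hb
    obtain ⟨c, hc⟩ := h.seq.exists_eq_smul hP h.isUniserial h.smul_eq_zero (hyk (k + 1))
    have h1 : t • ((c - b) • x (k + 1)) = 0 := by
      rw [smul_comm, h.seq.smul_succ, sub_smul, hb, ← hy, hc, smul_comm, h.seq.smul_succ, sub_self]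
    obtain ⟨d, hd⟩ := h.isUniserial.exists_eq_smul hP h.seq.one_ne (h.smul_eq_zero _ h1)
    refine ⟨b + d * t ^ k, ?_, ?_⟩
    · rw [add_smul, mul_smul, add_comm k 1, h.seq.pow_smul_add, ← hd, add_comm 1 k, sub_smul, ← hc]
      abel
    · rw [add_sub_cancel_left]
      exact Ideal.mul_mem_left _ _ (Ideal.pow_mem_pow h.mem k)
  choose f hf hf' using step
  let b : ∀ k, {b : A // b • x k = y k} := fun k => Nat.rec
    ⟨0, by rw [zero_smul, hy0]⟩ (fun k b => ⟨f k b.1 b.2, hf k b.1 b.2⟩) k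
  obtain ⟨u, hu⟩ := exists_proj_eq (fun k => (b k).1) fun k => hf' k (b k).1 (b k).2
  refine ⟨u, fun k => ?_⟩
  rw [smul_eq_smul (h.seq.smul_eq_zero_of_mem_pow hP h.isUniserial h.smul_eq_zero k) (hu k)]
  exact (b k).2

/-- On an infinite uniserial `P`-primary module, every element of the completed local ring acts
as zero or as the product of an automorphism and a power of `t`. -/
theorem exists_smul_eq_pow_smul (h : IsDivisibleUniserial P t x) {a : CompletedLocalization P}
    (ha : ∃ z : M, a • z ≠ 0) : ∃ (n : ℕ) (u v : CompletedLocalization P),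
      (∀ z : M, v • u • z = z) ∧ ∀ z : M, a • z = u • t ^ n • z := by
  classical
  have hex : ∃ k, a • x k ≠ 0 := by
    obtain ⟨z, hz⟩ := ha
    obtain ⟨k, c, rfl⟩ := h.exists_eq_smul z
    exact ⟨k, fun h0 => hz (by rw [smul_comm, h0, smul_zero])⟩
  -- Let `x (n + 1)` be the first term not killed by `a`. Then `k ↦ a x (n + k)` is again a division
  -- sequence, and comparing it with `x` in both directions gives `u` and its inverse `v`.
  obtain ⟨n, hn⟩ : ∃ n, Nat.find hex = n + 1 := by
    refine Nat.exists_eq_succ_of_ne_zero fun h0 => ?_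
    have := Nat.find_spec hex
    rw [h0, h.seq.zero, smul_zero] at this
    exact this rfl
  have hn0 : a • x n = 0 := by
    by_contra h0
    have := Nat.find_min' hex h0
    omega
  have hn1 : a • x (n + 1) ≠ 0 := hn ▸ Nat.find_spec hex
  have hy : ∀ k, t • (a • x (n + (k + 1))) = a • x (n + k) := fun k => by
    rw [smul_comm, ← add_assoc, h.seq.smul_succ]
  have h' : IsDivisibleUniserial P t fun k => a • x (n + k) :=
    ⟨h.isUniserial, h.primaryPart_eq_top, h.mem, h.smul_eq_zero, ⟨hn0, hn1, hy⟩⟩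
  obtain ⟨u, hu⟩ := h.exists_smul_eq (y := fun k => a • x (n + k)) hn0 hy
  obtain ⟨v, hv⟩ := h'.exists_smul_eq h.seq.zero h.seq.smul_succ
  refine ⟨n, u, v, fun z => ?_, fun z => ?_⟩
  · obtain ⟨k, c, rfl⟩ := h.exists_eq_smul z
    rw [smul_comm u, smul_comm v, hu, hv]
  · obtain ⟨k, c, rfl⟩ := h.exists_eq_smul z
    have h1 : a • x k = t ^ n • u • x k := by
      rw [hu, add_comm n k, smul_comm, h.seq.pow_smul_add]
    rw [smul_comm a, h1, smul_comm u, smul_comm u, smul_comm c]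

end IsDivisibleUniserial

end Divisible

section Annihilator

variable {C : Type*} [CommRing C] {M : Type*} [AddCommGroup M] [Module C M]

theorem mk_annihilator_eq_mk_iff {a b : C} :
    Ideal.Quotient.mk (Module.annihilator C M) a = Ideal.Quotient.mk _ b ↔
      ∀ z : M, a • z = b • z := by
  rw [Ideal.Quotient.eq, Module.mem_annihilator]
  exact forall_congr' fun z => by rw [sub_smul, sub_eq_zero]

theorem notMem_annihilator_iff {a : C} : a ∉ Module.annihilator C M ↔ ∃ z : M, a • z ≠ 0 := by
  rw [Module.mem_annihilator]
  push Not
  rfl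

end Annihilator

/-! ### The discrete valuation ring acting on an infinite uniserial module. -/

section DVR

variable {A : Type u} [CommRing A] {M : Type v} [AddCommGroup M] [Module A M]

/-- A division sequence that generates `M`, such that every element of the `A`-algebra `C` acts on
`M` as zero or as the product of an automorphism and a power of `t`. -/
structure IsUniformizing (C : Type*) [CommRing C] [Module C M] (t : A) (x : ℕ → M) : Prop where
  seq : IsDivisionSequence t x
  exists_eq_smul : ∀ z : M, ∃ (n : ℕ) (c : A), z = c • x n
  exists_smul_eq_pow_smul : ∀ {a : C}, (∃ z : M, a • z ≠ 0) → ∃ (n : ℕ) (u v : C),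
    (∀ z : M, v • u • z = z) ∧ ∀ z : M, a • z = u • t ^ n • z

namespace IsUniformizing

variable {C : Type*} [CommRing C] [Algebra A C] [Module C M] [IsScalarTower A C M]
  {t : A} {x : ℕ → M}

theorem annihilator_isPrime (h : IsUniformizing C t x) :
    (Module.annihilator C M).IsPrime := by
  refine ⟨?_, fun {a b} hab => ?_⟩
  · rw [Ideal.ne_top_iff_one, notMem_annihilator_iff]
    exact ⟨x 1, by rw [one_smul]; exact h.seq.one_ne⟩
  · by_contra! hn
    rw [notMem_annihilator_iff, notMem_annihilator_iff] at hn
    obtain ⟨n, u, v, huv, ha⟩ := h.exists_smul_eq_pow_smul hn.1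
    obtain ⟨m, u', v', huv', hb⟩ := h.exists_smul_eq_pow_smul hn.2
    -- If `a` and `b` act as automorphisms times `tⁿ` and `tᵐ`, then `a b` does not kill `x (n + m +
    -- 1)`.
    refine h.seq.pow_smul_ne_zero (Nat.lt_succ_self (n + m)) ?_
    have h1 := Module.mem_annihilator.1 hab (x (n + m + 1))
    rw [mul_smul, ha, hb, smul_comm (t ^ n) u', ← mul_smul (t ^ n)] at h1
    have h2 := congrArg (fun z => v' • v • z) h1
    simpa only [huv, huv', ← pow_add, smul_zero] using h2

/-- Every nonzero element modulo the annihilator is associated to a power of `t`. -/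
theorem associated_pow (h : IsUniformizing C t x)
    {β : C ⧸ Module.annihilator C M} (hβ : β ≠ 0) :
    ∃ n, Associated (algebraMap A _ t ^ n) β := by
  obtain ⟨a, rfl⟩ := Ideal.Quotient.mk_surjective β
  rw [ne_eq, Ideal.Quotient.eq_zero_iff_mem, notMem_annihilator_iff] at hβ
  obtain ⟨n, u, v, huv, ha⟩ := h.exists_smul_eq_pow_smul hβ
  have hvu : Ideal.Quotient.mk (Module.annihilator C M) u *
      Ideal.Quotient.mk _ v = 1 := by
    rw [← map_mul, ← map_one (Ideal.Quotient.mk _), mk_annihilator_eq_mk_iff]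
    intro z
    rw [mul_comm, mul_smul, huv, one_smul]
  refine ⟨n, ⟨_, _, hvu, by rw [mul_comm, hvu]⟩, ?_⟩
  rw [← map_pow, IsScalarTower.algebraMap_apply A C,
    Ideal.Quotient.algebraMap_eq]
  change Ideal.Quotient.mk _ _ * Ideal.Quotient.mk _ u = _
  rw [← map_mul, mk_annihilator_eq_mk_iff]
  intro z
  rw [ha, mul_comm, mul_smul, algebraMap_smul]

theorem isDiscreteValuationRing (h : IsUniformizing C t x) :
    ∃ _ : (Module.annihilator C M).IsPrime, IsDiscreteValuationRing
      (C ⧸ Module.annihilator C M) := by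
  have hQ := h.annihilator_isPrime
  refine ⟨hQ, IsDiscreteValuationRing.ofHasUnitMulPowIrreducibleFactorization
    ⟨algebraMap A _ t, ?_, fun hβ => h.associated_pow hβ⟩⟩
  set τ := algebraMap A
    (C ⧸ Module.annihilator C M) t with hτ
  have hτ' : τ = Ideal.Quotient.mk _ (algebraMap A C t) := by
    rw [hτ, IsScalarTower.algebraMap_apply A C,
      Ideal.Quotient.algebraMap_eq]
  have hu : ¬ IsUnit τ := by
    intro hu
    obtain ⟨β, hβ⟩ := hu.exists_right_inv
    obtain ⟨b, rfl⟩ := Ideal.Quotient.mk_surjective β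
    rw [hτ', ← map_mul, ← map_one (Ideal.Quotient.mk _), mk_annihilator_eq_mk_iff] at hβ
    have h1 := hβ (x 1)
    rw [one_smul, mul_comm, mul_smul, algebraMap_smul, h.seq.smul_succ, h.seq.zero,
      smul_zero] at h1
    exact h.seq.one_ne h1.symm
  have h0 : τ ≠ 0 := by
    rw [hτ', ne_eq, Ideal.Quotient.eq_zero_iff_mem, notMem_annihilator_iff]
    exact ⟨x 2, by rw [algebraMap_smul, h.seq.smul_succ]; exact h.seq.one_ne⟩
  refine ⟨hu, fun {α β} hαβ => ?_⟩
  have hα : α ≠ 0 := by rintro rfl; exact h0 (by rw [hαβ, zero_mul])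
  have hβ : β ≠ 0 := by rintro rfl; exact h0 (by rw [hαβ, mul_zero])
  obtain ⟨n, hn⟩ := h.associated_pow hα
  obtain ⟨m, hm⟩ := h.associated_pow hβ
  rcases n with _ | n
  · left
    rw [pow_zero] at hn
    exact associated_one_iff_isUnit.1 hn.symm
  rcases m with _ | m
  · right
    rw [pow_zero] at hm
    exact associated_one_iff_isUnit.1 hm.symm
  exfalso
  -- If both factors involve a positive power of `τ`, then `τ²` divides `τ`, making `τ` a unit.
  have h1 : τ * τ ∣ τ * 1 := by
    rw [mul_one]
    nth_rewrite 3 [hαβ]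
    refine mul_dvd_mul ((dvd_pow_self τ n.succ_ne_zero).trans hn.dvd)
      ((dvd_pow_self τ m.succ_ne_zero).trans hm.dvd)
  exact hu (isUnit_iff_dvd_one.2 ((mul_dvd_mul_iff_left h0).1 h1))

/-- Every fraction has the form `a / tⁿ` and is sent to `a x n`. If `a x n = 0` with `a` acting as
an automorphism times `tᵏ`, then `n ≤ k`, so the kernel is exactly `B`. -/
theorem nonempty_linearEquiv (h : IsUniformizing C t x)
    [(Module.annihilator C M).IsPrime] :
    Nonempty (M ≃ₗ[A] FracModSelf A
      (C ⧸ Module.annihilator C M)) := by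
  let B := C ⧸ Module.annihilator C M
  let K := FractionRing B
  let mk : C →+* B := Ideal.Quotient.mk (Module.annihilator C M)
  have hmk : ∀ a : A, mk (algebraMap A C a) = algebraMap A B a := fun _ => rfl
  have hinj : Function.Injective (algebraMap B K) := IsFractionRing.injective B K
  have hsm : ∀ (a : A) (z : K), a • z = algebraMap B K (mk (algebraMap A C a)) * z := by
    intro a z
    rw [hmk, ← Algebra.smul_def, algebraMap_smul]
  have ht0 : ∀ n, algebraMap B K (mk (algebraMap A C t)) ^ n ≠ 0 := by
    intro n
    refine pow_ne_zero _ ?_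
    rw [map_ne_zero_iff _ hinj, ne_eq, Ideal.Quotient.eq_zero_iff_mem, notMem_annihilator_iff]
    exact ⟨x 2, by rw [algebraMap_smul, h.seq.smul_succ]; exact h.seq.one_ne⟩
  have hex : ∀ z : K, ∃ na : ℕ × C, t ^ na.1 • z = algebraMap B K (mk na.2) := by
    intro z
    obtain ⟨⟨β, γ⟩, hz⟩ := IsLocalization.surj (nonZeroDivisors B) z
    obtain ⟨n, u, hu⟩ := h.associated_pow (nonZeroDivisors.ne_zero γ.2)
    obtain ⟨a, ha⟩ := Ideal.Quotient.mk_surjective (β * ((u⁻¹ : Bˣ) : B))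
    refine ⟨(n, a), ?_⟩
    have h1 : mk (algebraMap A C (t ^ n)) = γ * ((u⁻¹ : Bˣ) : B) := by
      rw [← hu, hmk, map_pow, mul_assoc, Units.mul_inv, mul_one]
    change t ^ n • z = algebraMap B K (mk a)
    rw [hsm, h1, map_mul, show mk a = _ from ha, map_mul, ← hz]
    ring
  choose r hr using hex
  have key : ∀ {z : K} {n : ℕ} {a : C}, t ^ n • z = algebraMap B K (mk a) →
      (r z).2 • x (r z).1 = a • x n := by
    intro z n a hz
    rcases hrz : r z with ⟨m, b⟩
    have h1 := hr z
    rw [hrz] at h1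
    have h2 : mk (algebraMap A C (t ^ n) * b) = mk (algebraMap A C (t ^ m) * a) := by
      apply hinj
      rw [map_mul, map_mul, map_mul, map_mul, ← hz, ← h1, hsm, hsm]
      ring
    rw [mk_annihilator_eq_mk_iff] at h2
    have h3 := h2 (x (n + m))
    rw [mul_comm, mul_smul, algebraMap_smul, mul_comm, mul_smul, algebraMap_smul,
      h.seq.pow_smul_add, add_comm, h.seq.pow_smul_add] at h3
    exact h3
  have hmk_pow : ∀ n, mk (algebraMap A C (t ^ n)) = mk (algebraMap A C t) ^ n := fun n => by
    rw [map_pow, map_pow]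
  let g : K →ₗ[A] M :=
    { toFun := fun z => (r z).2 • x (r z).1
      map_add' := by
        intro z w
        rcases hz : r z with ⟨n, a⟩
        rcases hw : r w with ⟨m, b⟩
        have h1 := hr z
        have h2 := hr w
        rw [hz] at h1
        rw [hw] at h2
        have h3 : t ^ (n + m) • (z + w) =
            algebraMap B K (mk (algebraMap A C (t ^ m) * a + algebraMap A C (t ^ n) * b)) := by
          rw [map_add, map_add, map_mul, map_mul, map_mul, map_mul, ← h1, ← h2, hsm, hsm, hsm]
          simp only [map_pow]
          ring
        rw [key h3, add_smul, mul_comm, mul_smul, algebraMap_smul, h.seq.pow_smul_add, mul_comm,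
          mul_smul, algebraMap_smul, add_comm n m, h.seq.pow_smul_add]
      map_smul' := by
        intro c z
        have h3 : t ^ (r z).1 • (c • z) =
            algebraMap B K (mk (algebraMap A C c * (r z).2)) := by
          rw [smul_comm, hr, hsm, map_mul, map_mul]
        rw [key h3, RingHom.id_apply, mul_smul, algebraMap_smul] }
  have hg : ∀ {z : K} {n : ℕ} {a : C}, t ^ n • z = algebraMap B K (mk a) → g z = a • x n := key
  have hsurj : Function.Surjective g := by
    intro y
    obtain ⟨n, c, rfl⟩ := h.exists_eq_smul y
    refine ⟨algebraMap B K (mk (algebraMap A C c)) / algebraMap B K (mk (algebraMap A C t)) ^ n, ?_⟩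
    rw [hg (n := n) (a := algebraMap A C c), algebraMap_smul]
    rw [hsm, hmk_pow, map_pow, mul_div_cancel₀ _ (ht0 n)]
  have hker : LinearMap.range (IsScalarTower.toAlgHom A B K).toLinearMap = LinearMap.ker g := by
    ext z
    rw [LinearMap.mem_ker]
    constructor
    · rintro ⟨β, rfl⟩
      obtain ⟨b, rfl⟩ := Ideal.Quotient.mk_surjective β
      rw [hg (n := 0) (a := b) (by rw [pow_zero, one_smul]; rfl), h.seq.zero, smul_zero]
    · intro hz
      have hz' : (r z).2 • x (r z).1 = 0 := hz
      by_cases ha : (r z).2 ∈ Module.annihilator C M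
      · have h1 := hr z
        rw [show mk (r z).2 = 0 from Ideal.Quotient.eq_zero_iff_mem.2 ha, map_zero, hsm, hmk_pow,
          map_pow, mul_eq_zero, or_iff_right (ht0 _)] at h1
        exact ⟨0, by rw [h1]; exact map_zero _⟩
      · obtain ⟨k, u, v, huv, hu⟩ := h.exists_smul_eq_pow_smul (notMem_annihilator_iff.1 ha)
        have hle : (r z).1 ≤ k := by
          by_contra! hlt
          refine h.seq.pow_smul_ne_zero hlt ?_
          rw [← huv (t ^ k • _), ← hu, hz', smul_zero]
        obtain ⟨d, rfl⟩ := Nat.exists_eq_add_of_le hle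
        have h2 : mk (r z).2 = mk (algebraMap A C (t ^ (r z).1)) *
            mk (u * algebraMap A C (t ^ d)) := by
          rw [← map_mul, mk_annihilator_eq_mk_iff]
          intro y
          rw [hu, mul_smul, mul_smul, algebraMap_smul, algebraMap_smul, pow_add, mul_smul,
            smul_comm u]
        refine ⟨mk (u * algebraMap A C (t ^ d)), ?_⟩
        have h1 := hr z
        rw [h2, map_mul, hsm, hmk_pow, map_pow] at h1
        exact (mul_left_cancel₀ (ht0 _) h1).symm
  exact ⟨((Submodule.quotEquivOfEq _ _ hker).trans (g.quotKerEquivOfSurjective hsurj)).symm⟩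

end IsUniformizing

theorem IsUniserial.isFracModDVR [IsNoetherianRing A] {P : Ideal A} [hP : P.IsMaximal]
    (hM : primaryPart P M = ⊤) (h : IsUniserial A M) (hfl : ¬ IsFiniteLength A M) :
    ∃ Q, IsFracModDVR P Q M := by
  obtain ⟨t, x, hx⟩ := h.exists_isDivisibleUniserial hP hM hfl
  obtain ⟨_, _⟩ := exists_module_completedLocalization hM
  have hx : IsUniformizing (CompletedLocalization P) t x :=
    ⟨hx.seq, hx.exists_eq_smul, hx.exists_smul_eq_pow_smul⟩
  obtain ⟨hQ, hdvr⟩ := hx.isDiscreteValuationRing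
  exact ⟨Module.annihilator (CompletedLocalization P) M, hP, hQ,
    IsPrincipalIdealRing.ringKrullDim_eq_one _ (IsDiscreteValuationRing.not_isField _), hdvr,
    hx.nonempty_linearEquiv⟩

end DVR

/-! ### The module `Frac(B) / B`. -/

section FracModSelf

variable {A B : Type*} [CommRing A] [CommRing B] [Algebra A B]

theorem FracModSelf.mk_eq_zero_iff {z : FractionRing B} :
    (Submodule.Quotient.mk z : FracModSelf A B) = 0 ↔ ∃ β, algebraMap B (FractionRing B) β = z :=
  Submodule.Quotient.mk_eq_zero _

/-- If `I` kills the class of `z`, then so does its extension to `C`; multiplication by `c` thus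
depends only on `c` modulo that extension. -/
theorem FracModSelf.mk_mul_eq_smul {C : Type*} [CommRing C] [Algebra A C] [Algebra C B]
    [IsScalarTower A C B] {I : Ideal A} {c : C} {a : A} {z : FractionRing B}
    (hz : ∀ b ∈ I, b • (Submodule.Quotient.mk z : FracModSelf A B) = 0)
    (hc : c - algebraMap A C a ∈ I.map (algebraMap A C)) :
    (Submodule.Quotient.mk (algebraMap B _ (algebraMap C B c) * z) : FracModSelf A B) =
      a • Submodule.Quotient.mk z := by
  have hsm : ∀ a : A, a • z = algebraMap B _ (algebraMap C B (algebraMap A C a)) * z := fun a => by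
    rw [← IsScalarTower.algebraMap_apply, ← Algebra.smul_def, algebraMap_smul]
  have h2 : ∀ d ∈ I.map (algebraMap A C),
      ∃ β, algebraMap B (FractionRing B) β = algebraMap B _ (algebraMap C B d) * z := by
    intro d hd
    induction hd using Submodule.span_induction with
    | mem d hd =>
      obtain ⟨b, hb, rfl⟩ := hd
      have h3 := hz b hb
      rwa [← Submodule.Quotient.mk_smul, FracModSelf.mk_eq_zero_iff, hsm] at h3
    | zero => exact ⟨0, by simp⟩
    | add d e _ _ hd he =>
      obtain ⟨β, hβ⟩ := hd
      obtain ⟨γ, hγ⟩ := he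
      exact ⟨β + γ, by rw [map_add, hβ, hγ, map_add, map_add, add_mul]⟩
    | smul r d _ hd =>
      obtain ⟨β, hβ⟩ := hd
      exact ⟨algebraMap C B r * β, by
        rw [map_mul, hβ, smul_eq_mul, map_mul, map_mul, mul_assoc]⟩
  have h3 := h2 _ hc
  rwa [← FracModSelf.mk_eq_zero_iff (A := A), map_sub, map_sub, sub_mul, ← hsm,
    Submodule.Quotient.mk_sub, sub_eq_zero] at h3

variable [IsDomain B] [IsDiscreteValuationRing B]

theorem eq_zero_of_forall_mul_mem_range {d : B}
    (hd : ∀ z : FractionRing B, ∃ β, algebraMap B (FractionRing B) β = algebraMap B _ d * z) :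
    d = 0 := by
  by_contra h0
  obtain ⟨ϖ, hϖ⟩ := IsDiscreteValuationRing.exists_irreducible B
  have hinj := IsFractionRing.injective B (FractionRing B)
  have hd' := (map_ne_zero_iff _ hinj).2 h0
  have hϖ' := (map_ne_zero_iff _ hinj).2 hϖ.ne_zero
  -- The test element `1 / (d ϖ)` would put `1 / ϖ` into `B`.
  obtain ⟨β, hβ⟩ := hd (algebraMap B _ d * algebraMap B _ ϖ)⁻¹
  refine hϖ.not_isUnit (IsUnit.of_mul_eq_one β (hinj ?_))
  rw [map_mul, hβ, map_one]
  field_simp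

variable (A B) in
theorem FracModSelf.nontrivial : Nontrivial (FracModSelf A B) := by
  by_contra h
  rw [not_nontrivial_iff_subsingleton] at h
  refine one_ne_zero (eq_zero_of_forall_mul_mem_range (d := (1 : B)) fun z => ?_)
  rw [map_one, one_mul]
  exact FracModSelf.mk_eq_zero_iff.1 (Subsingleton.elim (Submodule.Quotient.mk z : FracModSelf A B) 0)

variable (A B) in
-- A common denominator `d` of lifts of finitely many generators would satisfy `d Frac(B) ⊆ B`.
theorem FracModSelf.not_finite : ¬ Module.Finite A (FracModSelf A B) := by
  classical
  rintro ⟨s, hs⟩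
  choose r hr using fun x : FracModSelf A B => Submodule.Quotient.mk_surjective _ x
  obtain ⟨d, hd⟩ := IsLocalization.exist_integer_multiples_of_finset (nonZeroDivisors B)
    (s.image r)
  refine nonZeroDivisors.ne_zero d.2 (eq_zero_of_forall_mul_mem_range fun z => ?_)
  have key : ∀ x ∈ Submodule.span A (s : Set (FracModSelf A B)), ∃ w : FractionRing B,
      Submodule.Quotient.mk w = x ∧ ∃ β, algebraMap B (FractionRing B) β =
        algebraMap B _ d * w := by
    intro x hx
    induction hx using Submodule.span_induction with
    | mem x hx =>
      obtain ⟨β, hβ⟩ := hd _ (Finset.mem_image_of_mem r hx)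
      exact ⟨r x, hr x, β, by rw [hβ]; exact Algebra.smul_def _ _⟩
    | zero => exact ⟨0, rfl, 0, by simp⟩
    | add x y _ _ hx hy =>
      obtain ⟨w, rfl, β, hβ⟩ := hx
      obtain ⟨w', rfl, β', hβ'⟩ := hy
      exact ⟨w + w', rfl, β + β', by rw [map_add, hβ, hβ', mul_add]⟩
    | smul a x _ hx =>
      obtain ⟨w, rfl, β, hβ⟩ := hx
      refine ⟨a • w, rfl, a • β, ?_⟩
      rw [mul_smul_comm, ← hβ]
      exact (IsScalarTower.toAlgHom A B (FractionRing B)).toLinearMap.map_smul a β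
  obtain ⟨w, hw, β, hβ⟩ := key (Submodule.Quotient.mk z) (by rw [hs]; trivial)
  obtain ⟨γ, hγ⟩ := FracModSelf.mk_eq_zero_iff.1
    (show (Submodule.Quotient.mk (z - w) : FracModSelf A B) = 0 by
      rw [Submodule.Quotient.mk_sub, hw, sub_self])
  exact ⟨β + d * γ, by rw [map_add, map_mul, hβ, hγ]; ring⟩

theorem FracModSelf.primaryPart_eq_top {P : Ideal A}
    (hP : P.map (algebraMap A B) ≤ IsLocalRing.maximalIdeal B) :
    primaryPart P (FracModSelf A B) = ⊤ := by
  rw [eq_top_iff]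
  intro x _
  obtain ⟨z, rfl⟩ := Submodule.Quotient.mk_surjective _ x
  obtain ⟨⟨β, γ⟩, hz⟩ := IsLocalization.surj (nonZeroDivisors B) z
  obtain ⟨ϖ, hϖ⟩ := IsDiscreteValuationRing.exists_irreducible B
  obtain ⟨n, u, hu⟩ := IsDiscreteValuationRing.associated_pow_irreducible
    (nonZeroDivisors.ne_zero γ.2) hϖ
  refine ⟨n + 1, by omega, fun a ha => ?_⟩
  rw [← Submodule.Quotient.mk_smul, FracModSelf.mk_eq_zero_iff]
  have h1 : algebraMap A B a ∈ IsLocalRing.maximalIdeal B ^ n := by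
    refine Ideal.pow_right_mono hP n ?_
    rw [← Ideal.map_pow]
    exact Ideal.mem_map_of_mem _ (Ideal.pow_le_pow_right n.le_succ ha)
  rw [hϖ.maximalIdeal_eq, Ideal.span_singleton_pow, Ideal.mem_span_singleton'] at h1
  obtain ⟨c, hc⟩ := h1
  refine ⟨c * u * β, ?_⟩
  rw [← algebraMap_smul B a z, Algebra.smul_def, ← hc, ← hu, map_mul, ← hz, map_mul, map_mul,
    map_mul]
  ring

end FracModSelf

/-! ### Quotients of the completed local ring: converse and uniqueness. -/

section Completion

variable {A : Type u} [CommRing A] [IsNoetherianRing A]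

open CompletedLocalization

variable {P : Ideal A} [P.IsPrime] {Q : Ideal (CompletedLocalization P)}
  {M : Type v} [AddCommGroup M] [Module A M]

theorem map_le_maximalIdeal_quotient (hP : P.IsMaximal)
    [IsLocalRing (CompletedLocalization P ⧸ Q)] :
    P.map (algebraMap A (CompletedLocalization P ⧸ Q)) ≤ IsLocalRing.maximalIdeal _ := by
  rw [Ideal.map_le_iff_le_comap]
  intro p hp
  rw [Ideal.mem_comap, IsLocalRing.mem_maximalIdeal, mem_nonunits_iff,
    IsScalarTower.algebraMap_apply A (CompletedLocalization P), Ideal.Quotient.algebraMap_eq]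
  have hloc : IsLocalHom (Ideal.Quotient.mk Q) :=
    IsLocalHom.of_surjective _ Ideal.Quotient.mk_surjective
  intro hu
  exact (IsLocalRing.mem_maximalIdeal _).1 (algebraMap_mem_maximalIdeal hp) (hloc.map_nonunit _ hu)

/-- An element of the completed local ring acts on `Frac(B) / B` by multiplication. -/
theorem FracModSelf.mk_mul_eq_smul_of_proj_eq (hP : P.IsMaximal) {n : ℕ}
    {c : CompletedLocalization P} {a : A} {z : FractionRing (CompletedLocalization P ⧸ Q)}
    (hz : ∀ b ∈ P ^ n, b •
      (Submodule.Quotient.mk z : FracModSelf A (CompletedLocalization P ⧸ Q)) = 0)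
    (hc : proj P n c = Ideal.Quotient.mk (P ^ n) a) :
    (Submodule.Quotient.mk (algebraMap (CompletedLocalization P ⧸ Q) _
      (Ideal.Quotient.mk Q c) * z) : FracModSelf A (CompletedLocalization P ⧸ Q)) =
        a • Submodule.Quotient.mk z := by
  refine FracModSelf.mk_mul_eq_smul hz (mem_map_pow_of_proj_eq_zero ?_)
  rw [map_sub, hc, proj_algebraMap, sub_self]

/-- Of two nonzero fractions one is a `B`-multiple of the other, and on a `P`-primary class a
`B`-multiple is already an `A`-multiple. -/
theorem FracModSelf.isUniserial (hP : P.IsMaximal) [IsDomain (CompletedLocalization P ⧸ Q)]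
    [IsDiscreteValuationRing (CompletedLocalization P ⧸ Q)] :
    IsUniserial A (FracModSelf A (CompletedLocalization P ⧸ Q)) := by
  have htop := FracModSelf.primaryPart_eq_top (map_le_maximalIdeal_quotient (Q := Q) hP)
  have key : ∀ z w : FractionRing (CompletedLocalization P ⧸ Q),
      (∃ β : CompletedLocalization P ⧸ Q, algebraMap _ _ β * w = z) → ∃ a : A, (Submodule.Quotient.mk z :
        FracModSelf A (CompletedLocalization P ⧸ Q)) = a • Submodule.Quotient.mk w := by
    rintro z w ⟨β, rfl⟩
    obtain ⟨c, rfl⟩ := Ideal.Quotient.mk_surjective β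
    obtain ⟨n, a, hn, ha⟩ := exists_proj_eq_and_pow_smul htop c (Submodule.Quotient.mk w)
    exact ⟨a, FracModSelf.mk_mul_eq_smul_of_proj_eq hP hn ha⟩
  intro x y
  obtain ⟨z, rfl⟩ := Submodule.Quotient.mk_surjective _ x
  obtain ⟨w, rfl⟩ := Submodule.Quotient.mk_surjective _ y
  by_cases hz : z = 0
  · exact Or.inl (key z w ⟨0, by rw [hz, map_zero, zero_mul]⟩)
  by_cases hw : w = 0
  · exact Or.inr (key w z ⟨0, by rw [hw, map_zero, zero_mul]⟩)
  rcases ValuationRing.isInteger_or_isInteger (CompletedLocalization P ⧸ Q) (z / w) with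
    ⟨β, hβ⟩ | ⟨β, hβ⟩
  · exact Or.inl (key z w ⟨β, by rw [hβ, div_mul_cancel₀ _ hw]⟩)
  · exact Or.inr (key w z ⟨β, by rw [hβ, inv_div, div_mul_cancel₀ _ hz]⟩)

namespace IsFracModDVR

theorem primaryPart_eq_top (h : IsFracModDVR P Q M) : primaryPart P M = ⊤ := by
  obtain ⟨hP, hQ, -, hdvr, ⟨e⟩⟩ := h
  exact primaryPart_eq_top_of_equiv
    (FracModSelf.primaryPart_eq_top (map_le_maximalIdeal_quotient hP)) e.symm

theorem isUniserial (h : IsFracModDVR P Q M) : IsUniserial A M := by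
  obtain ⟨hP, hQ, -, hdvr, ⟨e⟩⟩ := h
  exact (FracModSelf.isUniserial hP).of_equiv e.symm

omit [IsNoetherianRing A] in
theorem nontrivial (h : IsFracModDVR P Q M) : Nontrivial M := by
  obtain ⟨hP, hQ, -, hdvr, ⟨e⟩⟩ := h
  have := FracModSelf.nontrivial A (CompletedLocalization P ⧸ Q)
  exact e.toEquiv.nontrivial

omit [IsNoetherianRing A] in
theorem not_finite (h : IsFracModDVR P Q M) : ¬ Module.Finite A M := by
  obtain ⟨hP, hQ, -, hdvr, ⟨e⟩⟩ := h
  intro _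
  exact FracModSelf.not_finite A (CompletedLocalization P ⧸ Q) (Module.Finite.equiv e)

theorem isArtinian (h : IsFracModDVR P Q M) : IsArtinian A M :=
  h.isUniserial.isArtinian h.1 h.primaryPart_eq_top

theorem associatedPrimes_eq (h : IsFracModDVR P Q M) : associatedPrimes A M = {P} :=
  have := h.nontrivial
  associatedPrimes_eq_of_primaryPart_eq_top h.1 h.primaryPart_eq_top

theorem exists_module (h : IsFracModDVR P Q M) :
    ∃ _ : Module (CompletedLocalization P) M, IsScalarTower A (CompletedLocalization P) M :=
  have := h.1
  exists_module_completedLocalization h.primaryPart_eq_top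

/-- Any compatible action agrees with multiplication on `Frac(B) / B`, as both are computed by
representatives in `A`; and only zero in `B` multiplies `Frac(B)` into `B`. -/
theorem annihilator_eq (h : IsFracModDVR P Q M) [Module (CompletedLocalization P) M]
    [IsScalarTower A (CompletedLocalization P) M] :
    Module.annihilator (CompletedLocalization P) M = Q := by
  have htop := h.primaryPart_eq_top
  obtain ⟨hP, hQ, -, hdvr, ⟨e⟩⟩ := h
  have key : ∀ (c : CompletedLocalization P) (z : FractionRing (CompletedLocalization P ⧸ Q)),
      e (c • e.symm (Submodule.Quotient.mk z)) =
        Submodule.Quotient.mk (algebraMap _ _ (Ideal.Quotient.mk Q c) * z) := by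
    intro c z
    obtain ⟨n, a, hn, ha⟩ := exists_proj_eq_and_pow_smul htop c (e.symm (Submodule.Quotient.mk z))
    rw [smul_eq_smul hn ha, map_smul, e.apply_symm_apply]
    refine (FracModSelf.mk_mul_eq_smul_of_proj_eq hP (fun b hb => ?_) ha).symm
    rw [← e.symm.map_eq_zero_iff, map_smul, hn b hb]
  ext c
  rw [Module.mem_annihilator]
  constructor
  · intro hc
    rw [← Ideal.Quotient.eq_zero_iff_mem]
    refine eq_zero_of_forall_mul_mem_range fun z => FracModSelf.mk_eq_zero_iff (A := A).1 ?_
    rw [← key, hc, map_zero]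
  · intro hc x
    obtain ⟨z, hz⟩ := Submodule.Quotient.mk_surjective _ (e x)
    have h1 := key c z
    rw [Ideal.Quotient.eq_zero_iff_mem.2 hc, map_zero, zero_mul, hz, e.symm_apply_apply] at h1
    exact e.injective (h1.trans (map_zero e).symm)

theorem unique {Q' : Ideal (CompletedLocalization P)} (h : IsFracModDVR P Q M)
    (h' : IsFracModDVR P Q' M) : Q' = Q := by
  obtain ⟨_, _⟩ := h.exists_module
  rw [← h.annihilator_eq, ← h'.annihilator_eq]

end IsFracModDVR

end Completion

theorem theorem1p3 {A : Type u} [CommRing A] [IsNoetherianRing A] :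
    -- modules with pairwise comaximal associated primes are the direct sum of their primary parts
    (∀ (M : Type v) [AddCommGroup M] [Module A M], PairwiseComaximal (associatedPrimes A M) →
      IsPrimaryDecomposition fun P : associatedPrimes A M => primaryPart P.1 M) ∧
    -- 1) meager modules decompose uniquely over their pairwise comaximal associated primes
    (∀ (M : Type v) [AddCommGroup M] [Module A M], IsMeager A M →
      PairwiseComaximal (associatedPrimes A M) ∧
      ∃! N : associatedPrimes A M → Submodule A M, IsPrimaryDecomposition N) ∧
    -- converse of 1)
    (∀ X : Set (Ideal A), (∀ P ∈ X, P.IsPrime) → PairwiseComaximal X →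
      ∀ (M : X → Type v) [∀ P, AddCommGroup (M P)] [∀ P, Module A (M P)],
        (∀ P, IsMeager A (M P) ∧ associatedPrimes A (M P) = {P.1}) →
        IsMeager A (⨁ P, M P)) ∧
    -- 2) a meager module with a single associated prime is of exactly one of three kinds
    (∀ (P : Ideal A) [P.IsPrime] (M : Type v) [AddCommGroup M] [Module A M],
      IsMeager A M → associatedPrimes A M = {P} →
        (IsUniserialOfFiniteLength A M ∨ (∃ Q, IsFracModDVR P Q M) ∨ IsDedekindRankOne P M) ∧
        ¬ (IsUniserialOfFiniteLength A M ∧ ∃ Q, IsFracModDVR P Q M) ∧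
        ¬ (IsUniserialOfFiniteLength A M ∧ IsDedekindRankOne P M) ∧
        ¬ ((∃ Q, IsFracModDVR P Q M) ∧ IsDedekindRankOne P M)) ∧
    -- kind (i): converse of 2), and complements
    (∀ (M : Type v) [AddCommGroup M] [Module A M], IsUniserialOfFiniteLength A M →
      IsMeager A M ∧ (∃ P : Ideal A, P.IsMaximal ∧ associatedPrimes A M = {P}) ∧
      IsArtinian A M ∧ Module.Finite A M) ∧
    -- kind (ii): converse of 2), uniqueness of `Q`, and complements; `M` carries a module
    -- structure over the completed local ring, and for any such structure the annihilator is `Q`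
    (∀ (P : Ideal A) [P.IsPrime] (Q : Ideal (CompletedLocalization P))
      (M : Type v) [AddCommGroup M] [Module A M], IsFracModDVR P Q M →
      IsMeager A M ∧ associatedPrimes A M = {P} ∧
      (∀ Q' : Ideal (CompletedLocalization P), IsFracModDVR P Q' M → Q' = Q) ∧
      IsArtinian A M ∧ ¬ Module.Finite A M ∧
      (∃ _ : Module (CompletedLocalization P) M, IsScalarTower A (CompletedLocalization P) M) ∧
      ∀ [Module (CompletedLocalization P) M] [IsScalarTower A (CompletedLocalization P) M],
        Module.annihilator (CompletedLocalization P) M = Q) ∧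
    -- kind (iii): converse of 2), and complements
    (∀ (P : Ideal A) [P.IsPrime] (M : Type v) [AddCommGroup M] [Module A M],
      IsDedekindRankOne P M →
      IsMeager A M ∧ associatedPrimes A M = {P} ∧
      ¬ IsArtinian A M ∧ Module.annihilator A M = P) ∧
    -- equivalent form of the condition on `M` in kind (iii)
    (∀ (P : Ideal A) [P.IsPrime] (M : Type v) [AddCommGroup M] [Module A M],
      IsTorsionFreeRankOne P M ↔
        ∃ N : Submodule A (FractionRing (A ⧸ P)), N ≠ ⊥ ∧ Nonempty (M ≃ₗ[A] N)) ∧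
    -- modules of kind (iii) may be finitely generated or not
    (∀ (P : Ideal A) [P.IsPrime], IsDedekindPrime P →
      IsDedekindRankOne P (A ⧸ P) ∧ Module.Finite A (A ⧸ P) ∧
      IsDedekindRankOne P (FractionRing (A ⧸ P)) ∧
      ¬ Module.Finite A (FractionRing (A ⧸ P))) := by
  refine ⟨fun M _ _ h => isPrimaryDecomposition_primaryPart h,
    fun M _ _ h => ⟨h.pairwiseComaximal, _,
      isPrimaryDecomposition_primaryPart h.pairwiseComaximal,
      fun N hN => hN.eq_primaryPart h.pairwiseComaximal⟩,
    fun X _ hX M _ _ hM => IsMeager.directSum hX (fun P => (hM P).1) fun P => (hM P).2,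
    fun P _ M _ _ h hM => ⟨?_, ?_, ?_, ?_⟩,
    fun M _ _ h => ⟨h.isUniserial.isMeager, h.exists_associatedPrimes_eq, h.isArtinian, h.finite⟩,
    fun P _ Q M _ _ h => ⟨h.isUniserial.isMeager, h.associatedPrimes_eq, fun Q' h' => h.unique h',
      h.isArtinian, h.not_finite, h.exists_module, fun {_ _} => h.annihilator_eq⟩,
    fun P _ M _ _ h => ⟨h.isMeager, h.2.associatedPrimes_eq, h.not_isArtinian,
      h.2.annihilator_eq⟩,
    fun P _ M _ _ => isTorsionFreeRankOne_iff_exists_submodule,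
    fun P _ h => ⟨h.quotient, inferInstance, h.fractionRing, h.not_finite_fractionRing⟩⟩
  · by_cases hP : P.IsMaximal
    · have htop := primaryPart_eq_top hM
      have hu := h.isUniserial hP htop
      by_cases hfl : IsFiniteLength A M
      · refine Or.inl ⟨?_, hfl, isUniserial_iff.1 hu⟩
        by_contra hnt
        rw [not_nontrivial_iff_subsingleton] at hnt
        rw [associatedPrimes.eq_empty_of_subsingleton] at hM
        exact Set.singleton_ne_empty _ hM.symm
      · exact Or.inr (Or.inl (hu.isFracModDVR htop hfl))
    · exact Or.inr (Or.inr (h.isDedekindRankOne hM hP))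
  -- Finite generation separates the first two kinds; being artinian separates each of them from the
  -- third.
  · rintro ⟨h1, Q, h2⟩
    exact h2.not_finite h1.finite
  · rintro ⟨h1, h2⟩
    exact h2.not_isArtinian h1.isArtinian
  · rintro ⟨⟨Q, h1⟩, h2⟩
    exact h2.not_isArtinian h1.isArtinian
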